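/- Let $U$ be a set with $|U|=n$, identified with $\{0,\dots,n-1\}$, and let $\mathbb{N}[(2^U,\cup)]$ be the set of vectors $v=(v_X)_{X\subseteq U}$ of natural numbers with coordinatewise addition and the product $(a*b)_Z=\sum_{X\cup Y=Z}a_Xb_Y$. Write $\mathrm{supp}(v)=\{X\subseteq U: v_X\neq 0\}$; a vector is a *singleton* if its support has exactly one element. A *circuit* $C$ over $\mathbb{N}[(2^U,\cup)]$ is a finite directed acyclic graph with a unique sink (the output gate), whose sources (the input gates) are labelled with elements of $\mathbb{N}[(2^U,\cup)]$ and whose other gates are labelled as addition or multiplication gates; each gate takes as its value its label, or the sum or the product of the values of its in-neighbours, and the output $v$ of $C$ is the value of the output gate. The circuit has *singleton inputs* if all labels of its input gates are singletons. Algorithms are programs with integer variables and indirectly addressed integer arrays, in the unit-cost model: every addition, subtraction, multiplication or comparison of integers, every branch and every memory access takes one unit of time, whatever the size of the integers. The input is $n$ together with $C$, given as a list of integers: the numbers of gates and of the output gate, and for each gate its type and either its label (the single non-zero value, and the index set $X\subseteq U$ as $n$ bits) or the list of its in-neighbours. The input size is the length $N$ of this list (so $N\geq n$), and $\mathcal{O}^*(f)$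 stands for at most $p(N)\cdot f$ with a fixed polynomial $p$ that depends only on the algorithm. **Theorem.** (a) There is an algorithm that, given $n$ and a circuit $C$ with singleton inputs over $\mathbb{N}[(2^U,\cup)]$ with output $v$, computes in time $\mathcal{O}^*(|\mathrm{supp}(v)|^2)$ a list that contains, for every $X\in\mathrm{supp}(v)$ exactly once (and for no other $X$), the set $X$ together with the value $v_X$. (b) There is an algorithm that, given $n$ and a circuit $C$ with singleton inputs over $\mathbb{N}[(2^U,\cup)]$ with output $v$, computes $v_U$, and whose running time is $\mathcal{O}^*(2^{(1-\alpha/2)n})$ for every real $\alpha$ with $0<\alpha\leq 1/2$ and $|\mathrm{supp}(v)|\leq 2^{(1-\alpha)n}$. The number $\alpha$ is not part of the input, and the suppressed polynomial does not depend on it. -/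

import Mathlib

namespace UnionCircuit

/-! ### The union algebra `ℕ[(2^U, ∪)]` -/

/-- The power set of `U`, regarded as a semigroup under union. -/
def UnionPow (U : Type) : Type := Finset U

instance (U : Type) [DecidableEq U] : DecidableEq (UnionPow U) :=
  inferInstanceAs (DecidableEq (Finset U))

/-- The product of two subsets is their union; the empty set is the neutral element. -/
instance (U : Type) [DecidableEq U] : CommMonoid (UnionPow U) where
  mul X Y := (X ∪ Y : Finset U)
  one := (∅ : Finset U)
  mul_assoc := Finset.union_assoc
  one_mul := Finset.empty_union
  mul_one := Finset.union_empty
  mul_comm := Finset.union_comm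

/-- `ℕ[(2^U, ∪)]` for `U = {0, …, n - 1}`: vectors of natural numbers indexed by the subsets of `U`,
with coordinatewise addition and the union product
`(a * b)_Z = ∑_{X ∪ Y = Z} a_X b_Y`. -/
abbrev UnionAlgebra (n : ℕ) : Type := MonoidAlgebra ℕ (UnionPow (Fin n))

/-- The coordinate `v_X` of a vector `v`. -/
def coord {n : ℕ} (v : UnionAlgebra n) (X : Finset (Fin n)) : ℕ := v.coeff X

/-- The support `{X ⊆ U : v_X ≠ 0}` of a vector `v`. -/
def supp {n : ℕ} (v : UnionAlgebra n) : Finset (Finset (Fin n)) := v.coeff.support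

/-- A vector is a singleton if exactly one of its coordinates is non-zero. -/
def IsSingleton {n : ℕ} (v : UnionAlgebra n) : Prop := (supp v).card = 1

/-- The singleton with value `w` on index `X`. -/
noncomputable def singleton {n : ℕ} (w : ℕ) (X : Finset (Fin n)) : UnionAlgebra n :=
  MonoidAlgebra.single (show UnionPow (Fin n) from X) w

/-! ### Circuits -/

/-- A gate of a circuit over `R` whose set of gates is `V`: an input gate with its label, or an
addition or multiplication gate with the ordered list of its in-neighbours. -/
inductive Gate (R V : Type) : Type
  | input (a : R)
  | add (l : List V)
  | mul (l : List V)

/-- The in-neighbours of a gate. -/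
def Gate.preds {R V : Type} : Gate R V → List V
  | .input _ => []
  | .add l => l
  | .mul l => l

/-- The ring element of a gate, as a function of those of its in-neighbours. -/
def Gate.combine {R V : Type} [Semiring R] (f : V → R) : Gate R V → R
  | .input a => a
  | .add l => (l.map f).sum
  | .mul l => (l.map f).prod

/-- A circuit over `R`: a labelled directed acyclic graph on the gates `0, …, size - 1` (in any
order) with a unique sink, the output gate. The sources are exactly the input gates. -/
structure Circuit (R : Type) where
  /-- the number of gates -/
  size : ℕ
  /-- the label of each gate, together with its in-neighbours -/
  gate : Fin size → Gate R (Fin size)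
  /-- a gate without in-neighbours is an input gate -/
  source_input : ∀ g, (gate g).preds = [] → ∃ a, gate g = .input a
  /-- the digraph has no directed cycle -/
  acyclic : ∀ g, ¬ Relation.TransGen (fun h g' => h ∈ (gate g').preds) g g
  /-- the output gate -/
  out : Fin size
  /-- the output gate is the unique sink -/
  sink_iff : ∀ g, (∀ h, g ∉ (gate h).preds) ↔ g = out

namespace Circuit

theorem arc_wf {R : Type} (C : Circuit R) :
    WellFounded (fun h g : Fin C.size => h ∈ (C.gate g).preds) := by
  have hirr : Std.Irrefl (Relation.TransGen fun h g : Fin C.size => h ∈ (C.gate g).preds) :=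
    ⟨C.acyclic⟩
  have hwf := Finite.wellFounded_of_trans_of_irrefl
    (Relation.TransGen fun h g : Fin C.size => h ∈ (C.gate g).preds)
  exact Subrelation.wf (fun h => Relation.TransGen.single h) hwf

/-- The ring element associated with a gate, by recursion along the arcs. -/
noncomputable def value {R : Type} [Semiring R] (C : Circuit R) : Fin C.size → R :=
  open Classical in
  C.arc_wf.fix fun g ih =>
    (C.gate g).combine fun h => if hh : h ∈ (C.gate g).preds then ih h hh else 0

/-- The defining equation of `value`: every gate combines the values of its in-neighbours. -/
theorem value_eq {R : Type} [Semiring R] (C : Circuit R) (g : Fin C.size) :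
    C.value g = (C.gate g).combine C.value := by
  classical
  have h : C.value g = (C.gate g).combine
      fun h => if h ∈ (C.gate g).preds then C.value h else 0 := by
    unfold value
    rw [WellFounded.fix_eq]
    simp
  rw [h]
  cases hg : C.gate g with
  | input a => rfl
  | add l =>
    simp only [Gate.combine, Gate.preds]
    congr 1
    exact List.map_congr_left fun x hx => by simp [hx]
  | mul l =>
    simp only [Gate.combine, Gate.preds]
    congr 1
    exact List.map_congr_left fun x hx => by simp [hx]

/-- The output of a circuit. -/
noncomputable def output {R : Type} [Semiring R] (C : Circuit R) : R := C.value C.out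

/-- Every input gate is labelled with a singleton. -/
def HasSingletonInputs {n : ℕ} (C : Circuit (UnionAlgebra n)) : Prop :=
  ∀ g a, C.gate g = .input a → IsSingleton a

end Circuit

/-! ### Circuits and tables as lists of integers -/

/-- A subset of `{0, …, n - 1}` is written as its `n` indicator bits. -/
def encodeSet {n : ℕ} (X : Finset (Fin n)) : List ℤ :=
  List.ofFn fun i => if i ∈ X then 1 else 0

/-- A gate of a circuit with singleton inputs: an input gate labelled with the singleton with value
`w` on index `X` is written as `0, w, X` (see `encodeGate_singleton`); an addition (multiplication)
gate as `1` (`2`), followed by the number and the list of its in-neighbours. -/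
noncomputable def encodeGate {n m : ℕ} : Gate (UnionAlgebra n) (Fin m) → List ℤ
  | .input a => 0 :: (∑ X ∈ supp a, (coord a X : ℤ)) :: encodeSet ((supp a).biUnion id)
  | .add l => 1 :: (l.length : ℤ) :: l.map fun h => ((h : ℕ) : ℤ)
  | .mul l => 2 :: (l.length : ℤ) :: l.map fun h => ((h : ℕ) : ℤ)

theorem encodeGate_singleton {n m : ℕ} (w : ℕ) (hw : w ≠ 0) (X : Finset (Fin n)) :
    encodeGate (m := m) (.input (singleton w X)) = 0 :: (w : ℤ) :: encodeSet X := by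
  have hs : supp (singleton w X) = {X} := Finsupp.support_single (M := ℕ) _ hw
  have hc : coord (singleton w X) X = w := Finsupp.single_eq_same
  simp [encodeGate, hs, hc]

/-- A circuit is written as `n`, the number of gates, the output gate, and then all its gates. The
length of this list (the number of integers in it) is the input size. -/
noncomputable def Circuit.encode {n : ℕ} (C : Circuit (UnionAlgebra n)) : List ℤ :=
  (n : ℤ) :: (C.size : ℤ) :: ((C.out : ℕ) : ℤ) :: (List.ofFn C.gate).flatMap encodeGate

/-- The list of the pairs `(X, v_X)`, for `X` running through the list `L`. -/
def encodeTable {n : ℕ} (v : UnionAlgebra n) (L : List (Finset (Fin n))) : List ℤ :=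
  L.flatMap fun X => encodeSet X ++ [(coord v X : ℤ)]

/-! ### Unit-cost random access programs

A program works on integer variables and on integer arrays that are addressed indirectly. An
addition, subtraction, multiplication, comparison, jump or access to memory takes one time unit,
whatever the size of the integers involved. There is no division and there are no operations on
bits. -/

/-- The contents of the variables and of the arrays. -/
structure State where
  /-- `var x` is the value of variable number `x` -/
  var : ℕ → ℤ
  /-- `arr a i` is the value of cell `i` of array number `a` -/
  arr : ℕ → ℤ → ℤ

/-- Integer expressions. -/
inductive Expr : Type
  | const (c : ℤ)
  | var (x : ℕ)
  | read (a : ℕ) (i : Expr)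
  | add (e f : Expr)
  | sub (e f : Expr)
  | mul (e f : Expr)

/-- The value of an expression. -/
def Expr.eval (s : State) : Expr → ℤ
  | .const c => c
  | .var x => s.var x
  | .read a i => s.arr a (i.eval s)
  | .add e f => e.eval s + f.eval s
  | .sub e f => e.eval s - f.eval s
  | .mul e f => e.eval s * f.eval s

/-- The number of time units that the evaluation of an expression takes. -/
def Expr.cost : Expr → ℕ
  | .const _ => 1
  | .var _ => 1
  | .read _ i => i.cost + 1
  | .add e f => e.cost + f.cost + 1
  | .sub e f => e.cost + f.cost + 1
  | .mul e f => e.cost + f.cost + 1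

/-- Programs. The branches and loops test whether the value of an expression is positive. -/
inductive Program : Type
  | skip
  | assign (x : ℕ) (e : Expr)
  | write (a : ℕ) (i e : Expr)
  | seq (P Q : Program)
  | ifPos (e : Expr) (P Q : Program)
  | whilePos (e : Expr) (P : Program)

/-- Assign the value `z` to variable `x`. -/
def State.setVar (s : State) (x : ℕ) (z : ℤ) : State :=
  { s with var := Function.update s.var x z }

/-- Assign the value `z` to cell `i` of array `a`. -/
def State.setArr (s : State) (a : ℕ) (i z : ℤ) : State :=
  { s with arr := Function.update s.arr a (Function.update (s.arr a) i z) }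

/-- `Exec P s s' t`: started in state `s`, the program `P` halts in state `s'` after `t` time
units. -/
inductive Exec : Program → State → State → ℕ → Prop
  | skip (s : State) : Exec .skip s s 1
  | assign (s : State) (x : ℕ) (e : Expr) :
      Exec (.assign x e) s (s.setVar x (e.eval s)) (e.cost + 1)
  | write (s : State) (a : ℕ) (i e : Expr) :
      Exec (.write a i e) s (s.setArr a (i.eval s) (e.eval s)) (i.cost + e.cost + 1)
  | seq {P Q : Program} {s s' s'' : State} {t t' : ℕ} :
      Exec P s s' t → Exec Q s' s'' t' → Exec (.seq P Q) s s'' (t + t')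
  | if_pos {e : Expr} {P Q : Program} {s s' : State} {t : ℕ} :
      0 < e.eval s → Exec P s s' t → Exec (.ifPos e P Q) s s' (e.cost + 1 + t)
  | if_neg {e : Expr} {P Q : Program} {s s' : State} {t : ℕ} :
      ¬ 0 < e.eval s → Exec Q s s' t → Exec (.ifPos e P Q) s s' (e.cost + 1 + t)
  | while_pos {e : Expr} {P : Program} {s s' s'' : State} {t t' : ℕ} :
      0 < e.eval s → Exec P s s' t → Exec (.whilePos e P) s' s'' t' →
      Exec (.whilePos e P) s s'' (e.cost + 1 + t + t')
  | while_neg {e : Expr} {P : Program} {s : State} :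
      ¬ 0 < e.eval s → Exec (.whilePos e P) s s (e.cost + 1)

/-- Programs are deterministic: the final state and the running time are unique. -/
theorem Exec.deterministic {P : Program} {s s₁ s₂ : State} {t₁ t₂ : ℕ}
    (h₁ : Exec P s s₁ t₁) (h₂ : Exec P s s₂ t₂) : s₁ = s₂ ∧ t₁ = t₂ := by
  induction h₁ generalizing s₂ t₂ with
  | skip | assign | write => cases h₂; exact ⟨rfl, rfl⟩
  | seq _ _ ih ih2 =>
    cases h₂ with
    | seq a b => obtain ⟨rfl, rfl⟩ := ih a; obtain ⟨rfl, rfl⟩ := ih2 b; exact ⟨rfl, rfl⟩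
  | if_pos h _ ih =>
    cases h₂ with
    | if_pos _ a => obtain ⟨rfl, rfl⟩ := ih a; exact ⟨rfl, rfl⟩
    | if_neg h2 _ => exact absurd h h2
  | if_neg h _ ih =>
    cases h₂ with
    | if_pos h2 _ => exact absurd h2 h
    | if_neg _ a => obtain ⟨rfl, rfl⟩ := ih a; exact ⟨rfl, rfl⟩
  | while_pos h _ _ ih ih2 =>
    cases h₂ with
    | while_pos _ a b =>
      obtain ⟨rfl, rfl⟩ := ih a; obtain ⟨rfl, rfl⟩ := ih2 b; exact ⟨rfl, rfl⟩
    | while_neg h2 => exact absurd h h2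
  | while_neg h =>
    cases h₂ with
    | while_pos h2 _ _ => exact absurd h2 h
    | while_neg _ => exact ⟨rfl, rfl⟩

/-- The initial state on input `l`: variable `0` holds the length of `l`, array `0` holds the
entries of `l` in its cells `0, 1, …`, and everything else is `0`. -/
def State.start (l : List ℤ) : State where
  var x := if x = 0 then (l.length : ℤ) else 0
  arr a i := if a = 0 ∧ 0 ≤ i then l.getD i.toNat 0 else 0

/-- The output of a final state is the list `l`: variable `1` holds the length of `l`, and array `1`
holds the entries of `l` in its cells `0, 1, …`. -/
def State.HasOutput (s : State) (l : List ℤ) : Prop :=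
  s.var 1 = (l.length : ℤ) ∧ ∀ i : ℕ, i < l.length → s.arr 1 (i : ℤ) = l.getD i 0

/-- On input `l`, the program `P` halts after `t` time units with output `l'`. -/
def Computes (P : Program) (l l' : List ℤ) (t : ℕ) : Prop :=
  ∃ s : State, Exec P (State.start l) s t ∧ s.HasOutput l'

end UnionCircuit

namespace UnionCircuit

/-! ### Running programs -/

/-! For fixed `Y ⊆ U` the map `v ↦ ∑_{X ⊆ Y} v_X` is a semiring homomorphism to `ℕ`, because a union
lies in `Y` iff both of its parts do. A value of the zeta transform of the output is therefore
obtained by evaluating the circuit over `ℕ`, each input singleton contributing its weight or `0`, in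
polynomially many unit-cost operations (`run_evalCircuit`). What remains is to limit the number of
queries.

Part (a). Given a list of support sets already found, subtract from the zeta value at `Y` the listed
values inside `Y`. The residual sums the coordinates at the unlisted subsets of `Y`, and it is
monotone in `Y` since coordinates are natural numbers. If it is positive at `U`, one greedy pass of
deletions reaches a minimal set with positive residual; such a set is a new member of the support,
and the residual there is its coordinate (`subsetSum_minimal`). Each new set costs `n + 1`
residuals, each residual one query and at most `|supp|` subtractions, hence `|supp|^2` in total.

Part (b). Number the sets as `2 ^ i * Z + X`, with `X` the part among the lowest `i` elements. Let
`lowSum` at `X` add up all coordinates with low part `X`, and let `topCoord` at `X` be the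
coordinate at `X` together with all upper elements. The zeta transform of `lowSum` costs one query
per value (`zeta_full_mul_add`), that of `topCoord` an alternating sum of `2 ^ (n - i)` queries
(`sum_bitSign_zeta`). By nonnegativity `topCoord` vanishes wherever `lowSum` does, so the expensive
sum is needed at only `lowCount` places. To profit from this, Möbius inversion is done online:
values appear in increasing order of `X`, and the transform at `X` is requested only if the value is
not already known to be zero (`run_updateRow`).

The work is about `2 ^ i + lowCount * 2 ^ (n - i)`. Since `lowCount ≤ |supp| ≤ 2 ^ ((1 - α) n)`, the
choice `i = ⌈(1 - α / 2) n⌉` balances the two terms (`two_pow_find_balanced_le`). As `α` is unknown,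
`i = 0, 1, …` are tried until the split is balanced; testing `i` costs only about `2 ^ i`. -/

@[simp] theorem State.setVar_var (s : State) (x y : ℕ) (z : ℤ) :
    (s.setVar x z).var y = if y = x then z else s.var y := by
  simp [State.setVar, Function.update_apply]

@[simp] theorem State.setVar_arr (s : State) (x : ℕ) (z : ℤ) : (s.setVar x z).arr = s.arr := rfl

@[simp] theorem State.setArr_var (s : State) (a : ℕ) (i z : ℤ) : (s.setArr a i z).var = s.var := rfl

@[simp] theorem State.setArr_arr (s : State) (a b : ℕ) (i z : ℤ) :
    (s.setArr a i z).arr b = if b = a then Function.update (s.arr a) i z else s.arr b := by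
  simp [State.setArr, Function.update_apply]

instance : Add Expr := ⟨.add⟩
instance : Sub Expr := ⟨.sub⟩
instance : Mul Expr := ⟨.mul⟩

@[simp] theorem Expr.eval_hAdd (s : State) (e f : Expr) : (e + f).eval s = e.eval s + f.eval s := rfl
@[simp] theorem Expr.eval_hSub (s : State) (e f : Expr) : (e - f).eval s = e.eval s - f.eval s := rfl
@[simp] theorem Expr.eval_hMul (s : State) (e f : Expr) : (e * f).eval s = e.eval s * f.eval s := rfl

attribute [simp] Expr.eval

/-- Whether the variable `x` is a target of an assignment in the program. -/
def Program.writesVar (x : ℕ) : Program → Bool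
  | .skip => false
  | .assign y _ => x == y
  | .write _ _ _ => false
  | .seq P Q => P.writesVar x || Q.writesVar x
  | .ifPos _ P Q => P.writesVar x || Q.writesVar x
  | .whilePos _ P => P.writesVar x

/-- Whether the program writes to the array `a`. -/
def Program.writesArr (a : ℕ) : Program → Bool
  | .skip => false
  | .assign _ _ => false
  | .write b _ _ => a == b
  | .seq P Q => P.writesArr a || Q.writesArr a
  | .ifPos _ P Q => P.writesArr a || Q.writesArr a
  | .whilePos _ P => P.writesArr a

/-- The states `s` and `s'` agree on all variables and arrays that `P` does not mention as a
target. -/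
structure Frame (P : Program) (s s' : State) : Prop where
  var : ∀ x, P.writesVar x = false → s'.var x = s.var x
  arr : ∀ a, P.writesArr a = false → s'.arr a = s.arr a

theorem Frame.refl (P : Program) (s : State) : Frame P s s := ⟨fun _ _ => rfl, fun _ _ => rfl⟩

theorem Frame.trans {P : Program} {s s' s'' : State} (h : Frame P s s') (h' : Frame P s' s'') :
    Frame P s s'' :=
  ⟨fun x hx => (h'.var x hx).trans (h.var x hx), fun a ha => (h'.arr a ha).trans (h.arr a ha)⟩

theorem Frame.mono {P Q : Program} {s s' : State} (h : Frame P s s')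
    (hv : ∀ x, Q.writesVar x = false → P.writesVar x = false)
    (ha : ∀ a, Q.writesArr a = false → P.writesArr a = false) : Frame Q s s' :=
  ⟨fun x hx => h.var x (hv x hx), fun a h' => h.arr a (ha a h')⟩

/-- The targets of a program are read off its text, so the side conditions of later frame arguments
are decided by computation, mostly by `rfl`. -/
theorem Exec.frame {P : Program} {s s' : State} {t : ℕ} (h : Exec P s s' t) : Frame P s s' := by
  induction h with
  | skip => exact Frame.refl _ _
  | assign s x e =>
    refine ⟨fun y hy => ?_, fun _ _ => rfl⟩
    simp only [Program.writesVar, beq_eq_false_iff_ne] at hy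
    simp [hy]
  | write s a i e =>
    refine ⟨fun _ _ => rfl, fun b hb => ?_⟩
    simp only [Program.writesArr, beq_eq_false_iff_ne] at hb
    simp [hb]
  | seq _ _ ih ih' =>
    exact (ih.mono (by simp +contextual [Program.writesVar])
      (by simp +contextual [Program.writesArr])).trans
      (ih'.mono (by simp +contextual [Program.writesVar]) (by simp +contextual [Program.writesArr]))
  | if_pos _ _ ih | if_neg _ _ ih =>
    exact ih.mono (by simp +contextual [Program.writesVar]) (by simp +contextual [Program.writesArr])
  | while_pos _ _ _ ih ih' =>
    exact (ih.mono (by simp [Program.writesVar]) (by simp [Program.writesArr])).trans ih'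
  | while_neg => exact Frame.refl _ _

/-- Started in state `s`, the program `P` halts after at most `T` time units in a state that
satisfies `Q`. -/
def Run (P : Program) (s : State) (T : ℕ) (Q : State → Prop) : Prop :=
  ∃ s' t, Exec P s s' t ∧ t ≤ T ∧ Q s'

namespace Run

variable {P P' : Program} {s : State} {T T' : ℕ} {Q Q' : State → Prop}

theorem mono (h : Run P s T Q) (hT : T ≤ T') : Run P s T' Q := by
  obtain ⟨s', t, h1, h2, h3⟩ := h
  exact ⟨s', t, h1, h2.trans hT, h3⟩

theorem imp (h : Run P s T Q) (hQ : ∀ s', Frame P s s' → Q s' → Q' s') : Run P s T Q' := by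
  obtain ⟨s', t, h1, h2, h3⟩ := h
  exact ⟨s', t, h1, h2, hQ s' h1.frame h3⟩

theorem skip (h : Q s) : Run .skip s 1 Q := ⟨s, 1, .skip s, le_rfl, h⟩

theorem assign {x : ℕ} {e : Expr} (h : Q (s.setVar x (e.eval s))) :
    Run (.assign x e) s (e.cost + 1) Q := ⟨_, _, .assign s x e, le_rfl, h⟩

theorem write {a : ℕ} {i e : Expr} (h : Q (s.setArr a (i.eval s) (e.eval s))) :
    Run (.write a i e) s (i.cost + e.cost + 1) Q := ⟨_, _, .write s a i e, le_rfl, h⟩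

theorem seq (h : Run P s T Q) (h' : ∀ s', Frame P s s' → Q s' → Run P' s' T' Q') :
    Run (.seq P P') s (T + T') Q' := by
  obtain ⟨s', t, h1, h2, h3⟩ := h
  obtain ⟨s'', t', h1', h2', h3'⟩ := h' s' h1.frame h3
  exact ⟨s'', _, .seq h1 h1', add_le_add h2 h2', h3'⟩

theorem assign_seq {x : ℕ} {e : Expr} (h : Run P (s.setVar x (e.eval s)) T Q) :
    Run (.seq (.assign x e) P) s (e.cost + 1 + T) Q := by
  obtain ⟨s', t, h1, h2, h3⟩ := h
  exact ⟨s', _, .seq (.assign s x e) h1, by omega, h3⟩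

theorem write_seq {a : ℕ} {i e : Expr} (h : Run P (s.setArr a (i.eval s) (e.eval s)) T Q) :
    Run (.seq (.write a i e) P) s (i.cost + e.cost + 1 + T) Q := by
  obtain ⟨s', t, h1, h2, h3⟩ := h
  exact ⟨s', _, .seq (.write s a i e) h1, by omega, h3⟩

theorem ifPos {e : Expr} (h : 0 < e.eval s → Run P s T Q) (h' : ¬ 0 < e.eval s → Run P' s T' Q) :
    Run (.ifPos e P P') s (e.cost + 1 + (T + T')) Q := by
  by_cases he : 0 < e.eval s
  · obtain ⟨s', t, h1, h2, h3⟩ := h he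
    exact ⟨s', _, .if_pos he h1, by omega, h3⟩
  · obtain ⟨s', t, h1, h2, h3⟩ := h' he
    exact ⟨s', _, .if_neg he h1, by omega, h3⟩

theorem if_pos {e : Expr} (he : 0 < e.eval s) (h : Run P s T Q) :
    Run (.ifPos e P P') s (e.cost + 1 + T) Q := by
  obtain ⟨s', t, h1, h2, h3⟩ := h
  exact ⟨s', _, .if_pos he h1, by omega, h3⟩

theorem if_neg {e : Expr} (he : ¬ 0 < e.eval s) (h : Run P' s T Q) :
    Run (.ifPos e P P') s (e.cost + 1 + T) Q := by
  obtain ⟨s', t, h1, h2, h3⟩ := h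
  exact ⟨s', _, .if_neg he h1, by omega, h3⟩

/-- A loop with an invariant `I k`, where `k` bounds the number of the remaining iterations. -/
theorem whilePos {e : Expr} (I : ℕ → State → Prop) {k : ℕ} (h : I k s)
    (hstep : ∀ k s, I k s → 0 < e.eval s → ∃ k', k = k' + 1 ∧ Run P s T (I k')) :
    Run (.whilePos e P) s (k * (T + e.cost + 1) + (e.cost + 1))
      (fun s' => ¬ 0 < e.eval s' ∧ ∃ k', I k' s') := by
  induction k generalizing s with
  | zero =>
    have he : ¬ 0 < e.eval s := fun he => by
      obtain ⟨k', hk, -⟩ := hstep _ _ h he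
      omega
    exact ⟨s, _, .while_neg he, by omega, he, _, h⟩
  | succ k ih =>
    by_cases he : 0 < e.eval s
    · obtain ⟨k', hk, s', t, h1, h2, h3⟩ := hstep _ _ h he
      obtain rfl : k = k' := by omega
      obtain ⟨s'', t', h1', h2', h3'⟩ := ih h3
      refine ⟨s'', _, .while_pos he h1 h1', ?_, h3'⟩
      rw [add_mul]
      omega
    · exact ⟨s, _, .while_neg he, by omega, he, _, h⟩

end Run

/-- The loop that runs `P` for the values `0, …, K - 1` of variable `x`, where `K` is the value of
variable `b`. -/
def forLoop (x b : ℕ) (P : Program) : Program :=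
  .seq (.assign x (.const 0))
    (.whilePos (.var b - .var x) (.seq P (.assign x (.var x + .const 1))))

/-- The bound may vary with the iteration, which is essential for a table in which only few rows are
expensive. Each iteration adds 4 units for the test and 4 for the increment; the initialisation and
the last, failing test account for the final 6. -/
theorem Run.forLoop_sum {x b : ℕ} {P : Program} {s : State} {K : ℕ} {T : ℕ → ℕ}
    (I : ℕ → State → Prop) (hx : P.writesVar x = false) (hb : P.writesVar b = false)
    (hbx : b ≠ x) (hK : s.var b = K) (h0 : I 0 (s.setVar x 0))
    (hstep : ∀ (k : ℕ) (s' : State), k < K → s'.var x = k → Frame (forLoop x b P) s s' → I k s' →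
      Run P s' (T k) (fun s'' => I (k + 1) (s''.setVar x ((k + 1 : ℕ) : ℤ)))) :
    Run (forLoop x b P) s ((∑ k ∈ Finset.range K, (T k + 8)) + 6) (I K) := by
  have key : ∀ (j k : ℕ) (s' : State), j + k = K → s'.var x = k → Frame (forLoop x b P) s s' → I k s' →
      Run (.whilePos (.var b - .var x) (.seq P (.assign x (.var x + .const 1)))) s'
        ((∑ i ∈ Finset.range j, (T (k + i) + 8)) + 4) (I K) := by
    intro j
    induction j with
    | zero =>
      intro k s' hk hxs hf hI
      obtain rfl : k = K := by omega
      refine ⟨s', _, .while_neg ?_, by simp [show (Expr.var b - Expr.var x).cost = 3 from rfl], hI⟩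
      have := hf.var b (by simp [forLoop, Program.writesVar, hb, hbx])
      simp [this, hK, hxs]
    | succ j ih =>
      intro k s' hk hxs hf hI
      have hbs := hf.var b (by simp [forLoop, Program.writesVar, hb, hbx])
      obtain ⟨s'', t, h1, h2, h3⟩ := hstep k s' (by omega) hxs hf hI
      have hx'' : s''.var x = k := (h1.frame.var x hx).trans hxs
      have hs : s''.setVar x ((Expr.var x + Expr.const 1).eval s'') =
          s''.setVar x ((k + 1 : ℕ) : ℤ) := by simp [hx'']
      have hex := Exec.seq h1 (.assign s'' x (.var x + .const 1))
      rw [hs] at hex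
      have hf' : Frame (forLoop x b P) s (s''.setVar x ((k + 1 : ℕ) : ℤ)) :=
        hf.trans (hex.frame.mono (by simp +contextual [forLoop, Program.writesVar])
          (by simp +contextual [forLoop, Program.writesArr]))
      obtain ⟨s3, t', h1', h2', h3'⟩ := ih (k + 1) _ (by omega) (by simp) hf' h3
      refine ⟨s3, _, .while_pos ?_ hex h1', ?_, h3'⟩
      · simp only [Expr.eval_hSub, Expr.eval, hbs, hxs, hK]
        omega
      · rw [Finset.sum_range_succ']
        simp only [show (Expr.var b - Expr.var x).cost = 3 from rfl,
          show (Expr.var x + Expr.const 1).cost = 3 from rfl]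
        have : ∀ i, k + 1 + i = k + (i + 1) := fun i => by omega
        simp only [this] at h2'
        simp only [add_zero]
        omega
  have := key K 0 (s.setVar x 0) (by omega) (by simp)
    ⟨fun y hy => by
      simp [forLoop, Program.writesVar] at hy
      simp [hy], fun _ _ => rfl⟩ h0
  refine (Run.assign_seq this).mono ?_
  simp [Expr.cost]
  omega

theorem Run.forLoop {x b : ℕ} {P : Program} {s : State} {K : ℕ} {T : ℕ}
    (I : ℕ → State → Prop) (hx : P.writesVar x = false) (hb : P.writesVar b = false)
    (hbx : b ≠ x) (hK : s.var b = K) (h0 : I 0 (s.setVar x 0))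
    (hstep : ∀ (k : ℕ) (s' : State), k < K → s'.var x = k → Frame (forLoop x b P) s s' → I k s' →
      Run P s' T (fun s'' => I (k + 1) (s''.setVar x ((k + 1 : ℕ) : ℤ)))) :
    Run (UnionCircuit.forLoop x b P) s (K * (T + 8) + 6) (I K) := by
  simpa using Run.forLoop_sum (T := fun _ => T) I hx hb hbx hK h0 hstep

/-- A bound on the running time of the program, provided that none of its loops makes more than `B`
iterations. -/
def Program.time (B : ℕ) : Program → ℕ
  | .skip => 1
  | .assign _ e => e.cost + 1
  | .write _ i e => i.cost + e.cost + 1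
  | .seq P Q => P.time B + Q.time B
  | .ifPos e P Q => e.cost + 1 + (P.time B + Q.time B)
  | .whilePos e P => B * (P.time B + e.cost + 1) + (e.cost + 1)

theorem Program.time_forLoop (B x b : ℕ) (P : Program) :
    (forLoop x b P).time B = B * (P.time B + 8) + 6 := by
  simp only [forLoop, time,
    show (Expr.var b - Expr.var x).cost = 3 from rfl, Expr.cost]
  ring

/-- For loops of at most `B` rounds the bound is a function of the program text alone. Taking the
input length for `B` makes it polynomial, so only exponentially long loops need explicit accounting.
-/
theorem Run.forLoop_time {x b : ℕ} {P : Program} {s : State} {K B : ℕ} (hB : K ≤ B)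
    (I : ℕ → State → Prop) (hx : P.writesVar x = false) (hb : P.writesVar b = false)
    (hbx : b ≠ x) (hK : s.var b = K) (h0 : I 0 (s.setVar x 0))
    (hstep : ∀ (k : ℕ) (s' : State), k < K → s'.var x = k →
      Frame (UnionCircuit.forLoop x b P) s s' → I k s' →
      Run P s' (P.time B) (fun s'' => I (k + 1) (s''.setVar x ((k + 1 : ℕ) : ℤ)))) :
    Run (UnionCircuit.forLoop x b P) s ((UnionCircuit.forLoop x b P).time B) (I K) :=
  (Run.forLoop I hx hb hbx hK h0 hstep).mono (by rw [Program.time_forLoop]; gcongr)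

/-- The function is bounded by a polynomial. -/
def PolyBounded (f : ℕ → ℕ) : Prop := ∃ p : Polynomial ℕ, ∀ B, f B ≤ p.eval B

theorem PolyBounded.const (c : ℕ) : PolyBounded fun _ => c := ⟨.C c, fun B => by simp⟩

theorem PolyBounded.id : PolyBounded fun B => B := ⟨.X, fun B => by simp⟩

theorem PolyBounded.add {f g : ℕ → ℕ} (hf : PolyBounded f) (hg : PolyBounded g) :
    PolyBounded fun B => f B + g B := by
  obtain ⟨p, hp⟩ := hf
  obtain ⟨q, hq⟩ := hg
  exact ⟨p + q, fun B => by simpa using add_le_add (hp B) (hq B)⟩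

theorem PolyBounded.mul {f g : ℕ → ℕ} (hf : PolyBounded f) (hg : PolyBounded g) :
    PolyBounded fun B => f B * g B := by
  obtain ⟨p, hp⟩ := hf
  obtain ⟨q, hq⟩ := hg
  exact ⟨p * q, fun B => by simpa using Nat.mul_le_mul (hp B) (hq B)⟩

/-- Each nested loop multiplies the bound by `B` once, and the nesting is fixed by the program. -/
theorem Program.time_polyBounded (P : Program) : PolyBounded fun B => P.time B := by
  induction P with
  | skip | assign | write => exact .const _
  | seq P Q hP hQ => exact hP.add hQ
  | ifPos e P Q hP hQ => exact (PolyBounded.const _).add (hP.add hQ)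
  | whilePos e P hP =>
    exact (PolyBounded.id.mul ((hP.add (.const _)).add (.const 1))).add (.const _)

end UnionCircuit

namespace UnionCircuit

/-! ### The zeta transform of a circuit -/

/-- The zeta transform at `Y`, as a homomorphism: the sum of the coordinates at the subsets of
`Y`. -/
noncomputable def zeta {n : ℕ} (Y : Finset (Fin n)) : UnionAlgebra n →+* ℕ :=
  (MonoidAlgebra.lift ℕ ℕ (UnionPow (Fin n))
    { toFun := fun X => if (show Finset (Fin n) from X) ⊆ Y then 1 else 0
      map_one' := if_pos (Finset.empty_subset Y)
      map_mul' := fun X X' => by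
        have h : (show Finset (Fin n) from X * X') ⊆ Y ↔ (show Finset (Fin n) from X) ⊆ Y ∧
          (show Finset (Fin n) from X') ⊆ Y := Finset.union_subset_iff
        simp only [h]
        split_ifs <;> simp_all }).toRingHom

theorem zeta_singleton {n : ℕ} (Y X : Finset (Fin n)) (w : ℕ) :
    zeta Y (singleton w X) = if X ⊆ Y then w else 0 := by
  refine (MonoidAlgebra.lift_single _ _ _).trans ?_
  show w • (if X ⊆ Y then 1 else 0) = _
  simp

theorem zeta_apply {n : ℕ} (Y : Finset (Fin n)) (v : UnionAlgebra n) :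
    zeta Y v = ∑ X ∈ supp v with X ⊆ Y, coord v X := by
  refine (MonoidAlgebra.lift_apply _ _).trans ?_
  rw [Finset.sum_filter]
  refine Finset.sum_congr rfl fun X _ => ?_
  show coord v X • (if (show Finset (Fin n) from X) ⊆ Y then 1 else 0) =
    if (show Finset (Fin n) from X) ⊆ Y then coord v X else 0
  simp

theorem IsSingleton.eq_singleton {n : ℕ} {a : UnionAlgebra n} (h : IsSingleton a) :
    ∃ w X, w ≠ 0 ∧ a = singleton w X := by
  obtain ⟨X, w, hw, h⟩ := Finsupp.card_support_eq_one'.1 h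
  exact ⟨w, X, hw, by ext; simp [singleton, h]; rfl⟩

theorem mem_supp {n : ℕ} {v : UnionAlgebra n} {X : Finset (Fin n)} :
    X ∈ supp v ↔ coord v X ≠ 0 := Finsupp.mem_support_iff

namespace Circuit

variable {R : Type} (C : Circuit R)

/-- The gates can be ranked in such a way that the arcs are increasing. -/
theorem exists_rank : ∃ r : Fin C.size → ℕ, (∀ g, r g < C.size) ∧
    ∀ g, ∀ h ∈ (C.gate g).preds, r h < r g := by
  classical
  refine ⟨fun g => (Finset.univ.filter fun h =>
    Relation.TransGen (fun h g' => h ∈ (C.gate g').preds) h g).card, fun g => ?_, fun g h hh => ?_⟩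
  · have h := Finset.card_lt_card (Finset.filter_ssubset
      (p := fun h => Relation.TransGen (fun h g' => h ∈ (C.gate g').preds) h g).2
        ⟨g, Finset.mem_univ g, C.acyclic g⟩)
    simpa using h
  · refine Finset.card_lt_card (Finset.ssubset_iff_of_subset ?_ |>.2 ⟨h, ?_, ?_⟩)
    · intro x hx
      simp only [Finset.mem_filter, Finset.mem_univ, true_and] at hx ⊢
      exact hx.tail hh
    · simpa using Relation.TransGen.single hh
    · simpa using C.acyclic h

/-- A circuit has an input gate. -/
theorem exists_input : ∃ g a, C.gate g = .input a := by
  obtain ⟨g, -, hg⟩ := C.arc_wf.has_min Set.univ ⟨C.out, trivial⟩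
  obtain ⟨a, ha⟩ := C.source_input g (List.eq_nil_iff_forall_not_mem.2 fun h => hg h trivial)
  exact ⟨g, a, ha⟩

end Circuit

variable {n : ℕ} (C : Circuit (UnionAlgebra n))

/-- All elements of a circuit with singleton inputs have non-empty support. -/
theorem zeta_univ_pos (hC : C.HasSingletonInputs) (g : Fin C.size) :
    0 < zeta Finset.univ (C.value g) := by
  -- The zeta transform at `U` is the sum of all coordinates. Being a homomorphism to `ℕ`, it turns
  -- the claim into: nonempty sums and arbitrary products of positive numbers are positive.
  induction g using C.arc_wf.induction with
  | _ g ih =>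
    rw [C.value_eq]
    cases hg : C.gate g with
    | input a =>
      obtain ⟨w, X, hw, rfl⟩ := (hC g a hg).eq_singleton
      simp only [Gate.combine, zeta_singleton, Finset.subset_univ, if_true]
      omega
    | add l =>
      cases l with
      | nil =>
        obtain ⟨a, ha⟩ := C.source_input g (by rw [hg]; rfl)
        simp [hg] at ha
      | cons x l =>
        have := ih x (by simp [hg, Gate.preds])
        simp only [Gate.combine, List.map_cons, List.sum_cons, map_add]
        omega
    | mul l =>
      simp only [Gate.combine, map_list_prod, List.map_map]
      refine List.prod_pos ?_
      simp only [List.mem_map, forall_exists_index, and_imp]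
      rintro _ x hx rfl
      exact ih x (by simpa [hg, Gate.preds] using hx)

/-- Needed because the time bound is a multiple of `|supp|^2`, which must not be zero. -/
theorem supp_output_nonempty (hC : C.HasSingletonInputs) : (supp C.output).Nonempty := by
  have h := zeta_univ_pos C hC C.out
  rw [zeta_apply] at h
  by_contra h'
  rw [Finset.not_nonempty_iff_eq_empty] at h'
  simp [Circuit.output] at h'
  simp [h'] at h

/-! ### The input list -/

/-- The position of gate `k` in the input list. -/
noncomputable def pos (k : ℕ) : ℕ := 3 + (((List.ofFn C.gate).take k).flatMap encodeGate).length

@[simp] theorem length_encodeSet (X : Finset (Fin n)) : (encodeSet X).length = n := by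
  simp [encodeSet]

theorem pos_zero : pos C 0 = 3 := by simp [pos]

theorem pos_succ (g : Fin C.size) : pos C (g + 1) = pos C g + (encodeGate (C.gate g)).length := by
  simp [pos, List.take_add_one, add_assoc]

theorem encode_drop (k : ℕ) :
    C.encode.drop (pos C k) = ((List.ofFn C.gate).drop k).flatMap encodeGate := by
  have h : (List.ofFn C.gate).flatMap encodeGate =
      ((List.ofFn C.gate).take k).flatMap encodeGate ++
        ((List.ofFn C.gate).drop k).flatMap encodeGate := by
    rw [← List.flatMap_append, List.take_append_drop]
  rw [pos, Circuit.encode, add_comm, List.drop_succ_cons, List.drop_succ_cons, List.drop_succ_cons, h]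
  simp

theorem encode_drop_eq_append (g : Fin C.size) : C.encode.drop (pos C g) =
    encodeGate (C.gate g) ++ ((List.ofFn C.gate).drop (g + 1)).flatMap encodeGate := by
  have h : (List.ofFn C.gate).drop g = C.gate g :: (List.ofFn C.gate).drop (g + 1) := by
    rw [List.drop_eq_getElem_cons (by simp)]
    simp
  rw [encode_drop, h, List.flatMap_cons]

theorem encode_getD (g : Fin C.size) (j : ℕ) (hj : j < (encodeGate (C.gate g)).length) :
    C.encode.getD (pos C g + j) 0 = (encodeGate (C.gate g)).getD j 0 := by
  have h : (C.encode.drop (pos C g)).getD j 0 = (encodeGate (C.gate g)).getD j 0 := by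
    rw [encode_drop_eq_append]
    simp [List.getD_eq_getElem?_getD, List.getElem?_append, hj]
  rw [← h]
  simp [List.getD_eq_getElem?_getD]

theorem size_le_length : C.size ≤ C.encode.length := by
  have : ∀ L : List (Gate (UnionAlgebra n) (Fin C.size)), L.length ≤ (L.flatMap encodeGate).length := by
    intro L
    induction L with
    | nil => simp
    | cons a L ih =>
      have : 1 ≤ (encodeGate a).length := by cases a <;> simp [encodeGate]
      simp only [List.length_cons, List.flatMap_cons, List.length_append]
      omega
  have h := this (List.ofFn C.gate)
  simp only [List.length_ofFn] at h
  simp only [Circuit.encode, List.length_cons]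
  omega

theorem length_gate_le (g : Fin C.size) : (encodeGate (C.gate g)).length ≤ C.encode.length := by
  have h := congrArg List.length (encode_drop_eq_append C g)
  simp only [List.length_drop, List.length_append] at h
  omega

/-- Some gate is an input gate, and its label spells out `n` bits. This makes the input length a
valid bound for loops over the ground set. -/
theorem n_le_length : n ≤ C.encode.length := by
  obtain ⟨g, a, hg⟩ := C.exists_input
  have h := length_gate_le C g
  rw [hg] at h
  simp only [encodeGate, List.length_cons, length_encodeSet] at h
  omega

end UnionCircuit

namespace UnionCircuit

theorem encodeGate_add {n m : ℕ} (l : List (Fin m)) :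
    encodeGate (n := n) (.add l) = 1 :: (l.length : ℤ) :: l.map fun h : Fin m => ((h : ℕ) : ℤ) := by
  simp [encodeGate, ← List.map_eq_flatMap]

theorem encodeGate_mul {n m : ℕ} (l : List (Fin m)) :
    encodeGate (n := n) (.mul l) = 2 :: (l.length : ℤ) :: l.map fun h : Fin m => ((h : ℕ) : ℤ) := by
  simp [encodeGate, ← List.map_eq_flatMap]

/-! ### Evaluation of the zeta transform

Variables `2`, `3`, `4` hold `n`, the number of gates and the output gate, array `2` holds the
indicator bits of the set `Y`, and array `3` holds the values of the gates. -/

/-- The input of the program is the circuit `C`, and the first three entries have been read. -/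
structure Loaded {n : ℕ} (C : Circuit (UnionAlgebra n)) (s : State) : Prop where
  arr : ∀ j : ℕ, s.arr 0 j = C.encode.getD j 0
  n : s.var 2 = n
  size : s.var 3 = C.size
  out : s.var 4 = (C.out : ℕ)

theorem Loaded.frame {n : ℕ} {C : Circuit (UnionAlgebra n)} {s s' : State} {P : Program}
    (h : Loaded C s) (hf : Frame P s s') (h0 : P.writesArr 0 = false) (h2 : P.writesVar 2 = false)
    (h3 : P.writesVar 3 = false) (h4 : P.writesVar 4 = false) : Loaded C s' where
  arr j := by rw [hf.arr 0 h0, h.arr]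
  n := by rw [hf.var 2 h2, h.n]
  size := by rw [hf.var 3 h3, h.size]
  out := by rw [hf.var 4 h4, h.out]

/-- Array `2` holds the indicator bits of `Y`. -/
def HoldsSet {n : ℕ} (Y : Finset (Fin n)) (s : State) : Prop :=
  ∀ j : Fin n, s.arr 2 (j : ℕ) = if j ∈ Y then 1 else 0

/-- Evaluates the input gate at position `var 6`. -/
def evalInput : Program :=
  .seq (.assign 9 (.var 8)) <|
  .seq (.assign 8 (.var 2)) <|
  forLoop 10 2 <| .assign 9 (.var 9 * (.const 1 -
    .read 0 (.var 6 + .const 2 + .var 10) * (.const 1 - .read 2 (.var 10))))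

/-- Evaluates the addition gate at position `var 6`. -/
def evalAdd : Program :=
  .seq (.assign 9 (.const 0)) <|
  forLoop 10 8 <| .assign 9 (.var 9 + .read 3 (.read 0 (.var 6 + .const 2 + .var 10)))

/-- Evaluates the multiplication gate at position `var 6`. -/
def evalMul : Program :=
  .seq (.assign 9 (.const 1)) <|
  forLoop 10 8 <| .assign 9 (.var 9 * .read 3 (.read 0 (.var 6 + .const 2 + .var 10)))

/-- Evaluates the gate number `var 7` at position `var 6` and moves on to the next gate. -/
def evalGate : Program :=
  .seq (.assign 8 (.read 0 (.var 6 + .const 1))) <|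
  .seq (.ifPos (.read 0 (.var 6)) (.ifPos (.read 0 (.var 6) - .const 1) evalMul evalAdd)
    evalInput) <|
  .seq (.write 3 (.var 7) (.var 9)) <|
  .assign 6 (.var 6 + .const 2 + .var 8)

/-- Stores the zeta transform at `Y` of the output of the circuit in variable `11`. -/
def evalCircuit : Program :=
  .seq (forLoop 5 3 <| .seq (.assign 6 (.const 3)) <| forLoop 7 3 evalGate) <|
  .assign 11 (.read 3 (.var 4))

variable {n : ℕ} {C : Circuit (UnionAlgebra n)} {Y : Finset (Fin n)} {s : State}

theorem Loaded.read (hs : Loaded C s) (g : Fin C.size) (hp : s.var 6 = (pos C g : ℕ)) (j : ℕ)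
    (hj : j < (encodeGate (C.gate g)).length) :
    s.arr 0 (s.var 6 + j) = (encodeGate (C.gate g)).getD j 0 := by
  rw [hp, ← encode_getD C g j hj, ← hs.arr]
  push_cast
  rfl

/-- The weight is multiplied by `1 - x (1 - y)` for the bits `x` of `X` and `y` of `Y`; this factor
is `0` if the element lies in `X` but not in `Y`, and `1` otherwise. The value left in variable `8`
lets the caller skip the `n` bits. -/
theorem run_evalInput (hs : Loaded C s) (hY : HoldsSet Y s) (g : Fin C.size)
    (hp : s.var 6 = (pos C g : ℕ)) {w : ℕ} {X : Finset (Fin n)} (hw : w ≠ 0)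
    (hg : C.gate g = .input (singleton w X)) (h8 : s.var 8 = w) :
    Run evalInput s (evalInput.time C.encode.length) fun s' =>
      s'.var 9 = (zeta Y (singleton w X) : ℕ) ∧ s'.var 8 = n := by
  refine Run.assign_seq <| Run.assign_seq ?_
  refine (Run.forLoop_time (K := n) (n_le_length C) (fun k s' => s'.var 8 = n ∧
    s'.var 9 = ((if ∀ j : Fin n, j < k → j ∈ X → j ∈ Y then w else 0 : ℕ) : ℤ)) rfl rfl (by decide)
    (by simp [hs.n]) (by simp [h8, hs.n]) ?_).imp ?_
  · intro k s' hk hx hf hI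
    refine Run.assign ?_
    have hr := hs.read g hp (2 + k) (by
      rw [hg, encodeGate_singleton w hw]
      simp
      omega)
    rw [hg, encodeGate_singleton w hw] at hr
    have h6 := hf.var 6 rfl
    have h0 := hf.arr 0 rfl
    have h2 := hf.arr 2 rfl
    simp at h6 h0 h2
    have hr' : s.arr 0 (s.var 6 + 2 + k) = if (⟨k, hk⟩ : Fin n) ∈ X then 1 else 0 := by
      push_cast at hr
      rw [add_assoc, hr, add_comm 2 k]
      simp [List.getD_eq_getElem?_getD, encodeSet, hk]
    have hY' := hY ⟨k, hk⟩
    refine ⟨by simp [hI.1], ?_⟩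
    simp [hx, hI.2, h0, h2, h6, hr', hY']
    have key : (∀ j : Fin n, (j : ℕ) ≤ k → j ∈ X → j ∈ Y) ↔
        (∀ j : Fin n, (j : ℕ) < k → j ∈ X → j ∈ Y) ∧ ((⟨k, hk⟩ : Fin n) ∈ X → (⟨k, hk⟩ : Fin n) ∈ Y) := by
      refine ⟨fun h => ⟨fun j hj => h j (by omega), h _ (by simp)⟩, fun h j hj => ?_⟩
      rcases Nat.lt_or_eq_of_le hj with hj | hj
      · exact h.1 j hj
      · obtain rfl : j = ⟨k, hk⟩ := Fin.ext hj
        exact h.2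
    simp only [key]
    split_ifs <;> simp_all
  · rintro s' hf ⟨h8', h9⟩
    refine ⟨?_, h8'⟩
    rw [h9, zeta_singleton]
    have : (∀ j : Fin n, (j : ℕ) < n → j ∈ X → j ∈ Y) ↔ X ⊆ Y :=
      ⟨fun h j hj => h j j.2 hj, fun h j _ hj => h hj⟩
    simp only [this]

theorem run_evalAdd (hs : Loaded C s) (g : Fin C.size)
    (hp : s.var 6 = (pos C g : ℕ)) {l : List (Fin C.size)} (hg : C.gate g = .add l)
    (h8 : s.var 8 = l.length) :
    Run evalAdd s (evalAdd.time C.encode.length) fun s' => s'.var 9 = (l.map fun h : Fin C.size => s.arr 3 (h : ℕ)).sum := by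
  have hlen := length_gate_le C g
  rw [hg, encodeGate_add] at hlen
  simp at hlen
  refine Run.assign_seq ?_
  refine (Run.forLoop_time (K := l.length) (by omega) (fun k s' =>
    s'.var 9 = ((l.take k).map fun h : Fin C.size => s.arr 3 (h : ℕ)).sum) rfl rfl (by decide)
    (by simp [h8]) (by simp) ?_).imp ?_
  · intro k s' hk hx hfr hI
    refine Run.assign ?_
    have hr := hs.read g hp (2 + k) (by
      rw [hg, encodeGate_add]
      simp
      omega)
    rw [hg, encodeGate_add] at hr
    have h6 := hfr.var 6 rfl
    have h0 := hfr.arr 0 rfl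
    have h3 := hfr.arr 3 rfl
    simp at h6 h0 h3
    have hr' : s.arr 0 (s.var 6 + 2 + k) = (l[k] : ℕ) := by
      push_cast at hr
      rw [add_assoc, hr, add_comm 2 k]
      simp [List.getD_eq_getElem?_getD, hk]
    rw [← List.take_append_getElem hk]
    simp [hx, hI, h0, h3, h6, hr', -List.take_append_getElem, -List.map_take]
  · intro s' _ h
    simpa using h

theorem run_evalMul (hs : Loaded C s) (g : Fin C.size)
    (hp : s.var 6 = (pos C g : ℕ)) {l : List (Fin C.size)} (hg : C.gate g = .mul l)
    (h8 : s.var 8 = l.length) :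
    Run evalMul s (evalMul.time C.encode.length) fun s' => s'.var 9 = (l.map fun h : Fin C.size => s.arr 3 (h : ℕ)).prod := by
  have hlen := length_gate_le C g
  rw [hg, encodeGate_mul] at hlen
  simp at hlen
  refine Run.assign_seq ?_
  refine (Run.forLoop_time (K := l.length) (by omega) (fun k s' =>
    s'.var 9 = ((l.take k).map fun h : Fin C.size => s.arr 3 (h : ℕ)).prod) rfl rfl (by decide)
    (by simp [h8]) (by simp) ?_).imp ?_
  · intro k s' hk hx hfr hI
    refine Run.assign ?_
    have hr := hs.read g hp (2 + k) (by
      rw [hg, encodeGate_mul]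
      simp
      omega)
    rw [hg, encodeGate_mul] at hr
    have h6 := hfr.var 6 rfl
    have h0 := hfr.arr 0 rfl
    have h3 := hfr.arr 3 rfl
    simp at h6 h0 h3
    have hr' : s.arr 0 (s.var 6 + 2 + k) = (l[k] : ℕ) := by
      push_cast at hr
      rw [add_assoc, hr, add_comm 2 k]
      simp [List.getD_eq_getElem?_getD, hk]
    rw [← List.take_append_getElem hk]
    simp [hx, hI, h0, h3, h6, hr', -List.take_append_getElem, -List.map_take]
  · intro s' _ h
    simpa using h

/-- Gates come in arbitrary order, so a gate may be processed before its in-neighbours. Hence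
correctness of the stored value is only conditional, while the position always advances correctly.
-/
theorem run_evalGate (hC : C.HasSingletonInputs) (hs : Loaded C s) (hY : HoldsSet Y s)
    (g : Fin C.size) (h7 : s.var 7 = (g : ℕ)) (hp : s.var 6 = (pos C g : ℕ)) :
    Run evalGate s (evalGate.time C.encode.length) fun s' =>
      s'.var 6 = (pos C (g + 1) : ℕ) ∧ (∀ h : Fin C.size, h ≠ g → s'.arr 3 (h : ℕ) = s.arr 3 (h : ℕ)) ∧
      ((∀ h ∈ (C.gate g).preds, s.arr 3 (h : ℕ) = (zeta Y (C.value h) : ℕ)) →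
        s'.arr 3 (g : ℕ) = (zeta Y (C.value g) : ℕ)) := by
  have hp0 := hs.read g hp 0
  have hp1 := hs.read g hp 1
  refine Run.assign_seq ?_
  set s₁ := s.setVar 8 ((Expr.read 0 (.var 6 + .const 1)).eval s) with hs₁
  have hL : Loaded C s₁ := ⟨hs.arr, by simp [hs₁, hs.n], by simp [hs₁, hs.size], by simp [hs₁, hs.out]⟩
  have hp' : s₁.var 6 = (pos C g : ℕ) := by simp [hs₁, hp]
  -- Whatever the type of the gate, variable `8` ends up as the number of entries after the first
  -- two: the in-degree, or `n` bits for an input gate.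
  refine Run.seq (Q := fun s' => ((∀ h ∈ (C.gate g).preds, s.arr 3 (h : ℕ) = (zeta Y (C.value h) : ℕ)) →
      s'.var 9 = (zeta Y (C.value g) : ℕ)) ∧
      s'.var 8 + 2 = ((encodeGate (C.gate g)).length : ℕ)) ?_ ?_
  · cases hg : C.gate g with
    | input a =>
      obtain ⟨w, X, hw, rfl⟩ := (hC g a hg).eq_singleton
      rw [hg, encodeGate_singleton w hw] at hp0 hp1
      simp at hp0 hp1
      refine (Run.if_neg (by simp [hs₁, hp0]) (run_evalInput hL hY g hp' hw hg (by simp [hs₁, hp1]))).mono ?_ |>.imp ?_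
      · simp only [Program.time]
        omega
      · rintro s' - ⟨h9, h8⟩
        rw [C.value_eq, hg]
        refine ⟨fun _ => h9, ?_⟩
        rw [encodeGate_singleton w hw]
        simp [h8]
        omega
    | add l =>
      rw [hg, encodeGate_add] at hp0 hp1
      simp at hp0 hp1
      refine ((Run.if_pos (by simp [hs₁, hp0]) <| Run.if_neg (by simp [hs₁, hp0]) <|
        (run_evalAdd hL g hp' hg (by simp [hs₁, hp1])).imp fun s' hf h9 =>
          show _ ∧ s'.var 8 = s₁.var 8 from ⟨h9, hf.var 8 rfl⟩).mono ?_).imp ?_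
      · simp only [Program.time]
        omega
      · rintro s' - ⟨h9, h8⟩
        rw [encodeGate_add]
        refine ⟨fun h => ?_, by simp [h8, hs₁, hp1]; ring⟩
        rw [C.value_eq, hg, h9, Gate.combine, map_list_sum, Nat.cast_list_sum]
        simp only [List.map_map]
        exact congrArg List.sum (List.map_congr_left fun x hx => h x hx)
    | mul l =>
      rw [hg, encodeGate_mul] at hp0 hp1
      simp at hp0 hp1
      refine ((Run.if_pos (by simp [hs₁, hp0]) <| Run.if_pos (by simp [hs₁, hp0]) <|
        (run_evalMul hL g hp' hg (by simp [hs₁, hp1])).imp fun s' hf h9 =>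
          show _ ∧ s'.var 8 = s₁.var 8 from ⟨h9, hf.var 8 rfl⟩).mono ?_).imp ?_
      · simp only [Program.time]
        omega
      · rintro s' - ⟨h9, h8⟩
        rw [encodeGate_mul]
        refine ⟨fun h => ?_, by simp [h8, hs₁, hp1]; ring⟩
        rw [C.value_eq, hg, h9, Gate.combine, map_list_prod, Nat.cast_list_prod]
        simp only [List.map_map]
        exact congrArg List.prod (List.map_congr_left fun x hx => h x hx)
  · rintro s' hf ⟨h9, h8⟩
    refine Run.write_seq (Run.assign ?_)
    have h6' := hf.var 6 rfl
    have h7' := hf.var 7 rfl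
    have h3' := hf.arr 3 rfl
    simp [hs₁] at h6' h7' h3'
    refine ⟨?_, ?_, ?_⟩
    · simp [h6', hp, pos_succ, ← h8]
      ring
    · intro h hh
      have : ((h : ℕ) : ℤ) ≠ ((g : ℕ) : ℤ) := by exact_mod_cast fun h' => hh (Fin.ext h')
      simp [h3', h7', h7, this]
    · intro h
      simp [h7', h7, h9 h]

/-- No topological sorting is needed: the list of gates is swept as many times as there are gates,
and after `k` sweeps all gates of rank below `k` hold their final values. -/
theorem run_evalCircuit (hC : C.HasSingletonInputs) (hs : Loaded C s) (hY : HoldsSet Y s) :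
    Run evalCircuit s (evalCircuit.time C.encode.length) fun s' =>
      s'.var 11 = (zeta Y C.output : ℕ) := by
  obtain ⟨r, hr, hr'⟩ := C.exists_rank
  refine Run.seq (Run.forLoop_time (size_le_length C) (fun k s' => ∀ h : Fin C.size, r h < k →
    s'.arr 3 (h : ℕ) = (zeta Y (C.value h) : ℕ)) rfl rfl (by decide) hs.size (by simp) ?_) ?_
  · intro k s₁ hk hx hf hI
    refine Run.assign_seq ?_
    have hL := hs.frame hf rfl rfl rfl rfl
    -- Within sweep `k`, the gates of rank `k` become correct as they are passed. Gates of smaller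
    -- rank are recomputed from correct in-neighbours and stay correct.
    refine (Run.forLoop_time (size_le_length C) (fun g s' => s'.var 6 = (pos C g : ℕ) ∧
      ∀ h : Fin C.size, (r h < k ∨ r h = k ∧ h < g) → s'.arr 3 (h : ℕ) = (zeta Y (C.value h) : ℕ))
      rfl rfl (by decide) (by simp [hL.size]) ?_ ?_).imp ?_
    · simpa [pos_zero] using hI
    · rintro g s₂ hg hx₂ hf₂ ⟨h6, hI₂⟩
      have hL₂ : Loaded C s₂ :=
        ⟨fun j => by simpa [hf₂.arr 0 rfl] using hL.arr j, by simpa [hf₂.var 2 rfl] using hL.n,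
          by simpa [hf₂.var 3 rfl] using hL.size, by simpa [hf₂.var 4 rfl] using hL.out⟩
      have hY₂ : HoldsSet Y s₂ := fun j => by
        rw [hf₂.arr 2 rfl, State.setVar_arr, hf.arr 2 rfl, hY j]
      refine (run_evalGate hC hL₂ hY₂ ⟨g, hg⟩ hx₂ h6).imp ?_
      rintro s₃ hf₃ ⟨h6', hne, hnew⟩
      refine ⟨by simp [h6'], fun h hh => ?_⟩
      simp only [State.setVar_arr]
      by_cases hgh : h = ⟨g, hg⟩
      · subst hgh
        refine hnew fun h' hh' => hI₂ h' (Or.inl ?_)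
        have := hr' _ _ hh'
        omega
      · rw [hne h hgh]
        have : (h : ℕ) ≠ g := fun h' => hgh (Fin.ext h')
        exact hI₂ h (by omega)
    · rintro s₃ - ⟨-, h3⟩ h hh
      have := h.2
      exact h3 h (by omega)
  · intro s' hf h
    refine Run.assign ?_
    have := h C.out (hr _)
    simp [hf.var 4 rfl, hs.out, this, Circuit.output]

end UnionCircuit

namespace UnionCircuit

/-! ### Listing the support -/

variable {n : ℕ} {C : Circuit (UnionAlgebra n)} {Y : Finset (Fin n)} {s : State}

theorem length_encodeTable (v : UnionAlgebra n) (L : List (Finset (Fin n))) :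
    (encodeTable v L).length = L.length * (n + 1) := by
  simp [encodeTable]

theorem encodeTable_concat (v : UnionAlgebra n) (L : List (Finset (Fin n))) (X : Finset (Fin n)) :
    encodeTable v (L ++ [X]) = encodeTable v L ++ (encodeSet X ++ [(coord v X : ℤ)]) := by
  simp [encodeTable]

theorem encodeTable_getD (v : UnionAlgebra n) (L : List (Finset (Fin n))) (k : ℕ)
    (hk : k < L.length) (j : ℕ) (hj : j ≤ n) : (encodeTable v L).getD (k * (n + 1) + j) 0 =
      (encodeSet L[k] ++ [(coord v L[k] : ℤ)]).getD j 0 := by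
  have h : encodeTable v L = encodeTable v (L.take k) ++ ((encodeSet L[k] ++ [(coord v L[k] : ℤ)]) ++
      encodeTable v (L.drop (k + 1))) := by
    simp only [encodeTable]
    rw [← List.flatMap_cons (f := fun X => encodeSet X ++ [(coord v X : ℤ)]),
      ← List.drop_eq_getElem_cons hk, ← List.flatMap_append, List.take_append_drop]
  have hl : (encodeTable v (L.take k)).length = k * (n + 1) := by
    rw [length_encodeTable, List.length_take, min_eq_left hk.le]
  rw [h, ← hl, List.getD_append_right _ _ _ _ (by omega), Nat.add_sub_cancel_left,
    List.getD_append _ _ _ _ (by simp; omega)]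

theorem encodeSet_getD (X : Finset (Fin n)) (j : Fin n) :
    (encodeSet X).getD j 0 = if j ∈ X then 1 else 0 := by
  simp [List.getD_eq_getElem?_getD, encodeSet]

/-- The sum of the coordinates at the members of `S` that are contained in `Y`. -/
def subsetSum (v : UnionAlgebra n) (S : Finset (Finset (Fin n))) (Y : Finset (Fin n)) : ℕ :=
  ∑ X ∈ S with X ⊆ Y, coord v X

/-- Monotonicity is what makes a single pass of deletions sufficient: a deletion that once failed
would fail for every smaller set too. -/
theorem subsetSum_mono (v : UnionAlgebra n) (S : Finset (Finset (Fin n))) {Y Y' : Finset (Fin n)}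
    (h : Y ⊆ Y') : subsetSum v S Y ≤ subsetSum v S Y' :=
  Finset.sum_le_sum_of_subset (Finset.monotone_filter_right S fun _ _ hX => hX.trans h)

/-- A minimal set with a non-zero subset sum belongs to the family. -/
theorem subsetSum_minimal {v : UnionAlgebra n} {S : Finset (Finset (Fin n))}
    (h : 0 < subsetSum v S Y) (hmin : ∀ j ∈ Y, subsetSum v S (Y.erase j) = 0) :
    Y ∈ S ∧ subsetSum v S Y = coord v Y := by
  -- A member strictly inside `Y` misses some `j ∈ Y`, so it is counted at `Y.erase j`, where the
  -- sum vanishes.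
  have key : ∀ X ∈ S, X ⊆ Y → coord v X ≠ 0 → X = Y := by
    intro X hX hXY h0
    by_contra hne
    obtain ⟨j, hj, hjX⟩ := Finset.exists_of_ssubset (hXY.ssubset_of_ne hne)
    exact h0 (Finset.sum_eq_zero_iff.1 (hmin j hj) X
      (Finset.mem_filter.2 ⟨hX, Finset.subset_erase.2 ⟨hXY, hjX⟩⟩))
  obtain ⟨X, hX, h0⟩ := Finset.exists_ne_zero_of_sum_ne_zero h.ne'
  rw [Finset.mem_filter] at hX
  obtain rfl := key X hX.1 hX.2 h0
  refine ⟨hX.1, Finset.sum_eq_single_of_mem X (Finset.mem_filter.2 hX) fun X' hX' hne => ?_⟩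
  rw [Finset.mem_filter] at hX'
  by_contra h0'
  exact hne (key X' hX'.1 hX'.2 h0')

/-- Variable `12` and the output hold the table of the sets in `L`. -/
structure HoldsTable (v : UnionAlgebra n) (L : List (Finset (Fin n))) (s : State) : Prop where
  count : s.var 12 = L.length
  output : s.HasOutput (encodeTable v L)

theorem HoldsTable.frame {v : UnionAlgebra n} {L : List (Finset (Fin n))} {s' : State} {P : Program}
    (h : HoldsTable v L s) (hf : Frame P s s') (h1 : P.writesVar 1 = false)
    (h12 : P.writesVar 12 = false) (ha : P.writesArr 1 = false) : HoldsTable v L s' where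
  count := by rw [hf.var 12 h12, h.count]
  output := by
    rw [State.HasOutput, hf.var 1 h1, hf.arr 1 ha]
    exact h.output

theorem HoldsSet.frame {s' : State} {P : Program} (h : HoldsSet Y s) (hf : Frame P s s')
    (ha : P.writesArr 2 = false) : HoldsSet Y s' := fun j => by rw [hf.arr 2 ha, h j]

/-- Subtracts the value of entry number `var 13` of the table if its set is contained in `Y`. -/
def subtractEntry : Program :=
  .seq (.assign 14 (.read 1 (.var 13 * (.var 2 + .const 1) + .var 2))) <|
  .seq (forLoop 15 2 <| .assign 14 (.var 14 * (.const 1 -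
    .read 1 (.var 13 * (.var 2 + .const 1) + .var 15) * (.const 1 - .read 2 (.var 15))))) <|
  .assign 11 (.var 11 - .var 14)

/-- Stores in variable `11` the sum of the values at the subsets of `Y` that are not in the
table. -/
def residual : Program := .seq evalCircuit (forLoop 13 12 subtractEntry)

/-- A bound on the running time of `residual` for a table with `M` entries. -/
def residualTime (N M : ℕ) : ℕ := evalCircuit.time N + (M * (subtractEntry.time N + 8) + 6)

/-- The inclusion test is the same product of bit factors as at an input gate. Entry `k` occupies a
block of `n + 1` cells, with the bits first and the value last. -/
theorem run_subtractEntry {v : UnionAlgebra n} {L : List (Finset (Fin n))} {N : ℕ} (hN : n ≤ N)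
    (hn : s.var 2 = n) (hY : HoldsSet Y s) (hL : HoldsTable v L s) {k : ℕ} (hk : k < L.length)
    (h13 : s.var 13 = k) :
    Run subtractEntry s (subtractEntry.time N) fun s' =>
      s'.var 11 = s.var 11 - if L[k] ⊆ Y then (coord v L[k] : ℤ) else 0 := by
  have hlt : ∀ j ≤ n, k * (n + 1) + j < (encodeTable v L).length := by
    intro j hj
    rw [length_encodeTable]
    nlinarith
  have hval : s.arr 1 (k * (n + 1) + n) = coord v L[k] := by
    have := hL.output.2 _ (hlt n le_rfl)
    rw [encodeTable_getD v L k hk n le_rfl, List.getD_append_right _ _ _ _ (by simp)] at this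
    push_cast at this
    simp [this]
  have hbit : ∀ j : Fin n, s.arr 1 (k * (n + 1) + (j : ℕ)) = if j ∈ L[k] then 1 else 0 := by
    intro j
    have := hL.output.2 _ (hlt j j.2.le)
    rw [encodeTable_getD v L k hk j j.2.le, List.getD_append _ _ _ _ (by simp), encodeSet_getD] at this
    push_cast at this
    exact this
  refine Run.assign_seq (Run.seq (Run.forLoop_time (K := n) hN (fun i s' =>
    s'.var 14 = ((if ∀ j : Fin n, (j : ℕ) < i → j ∈ L[k] → j ∈ Y then coord v L[k] else 0 : ℕ) : ℤ))
    rfl rfl (by decide) (by simp [hn]) (by simp [h13, hn, hval]) ?_) ?_)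
  · intro i s' hi hx hf hI
    refine Run.assign ?_
    have h13' := hf.var 13 rfl
    have h2' := hf.var 2 rfl
    have h1 := hf.arr 1 rfl
    have h2 := hf.arr 2 rfl
    simp at h13' h2' h1 h2
    have hb := hbit ⟨i, hi⟩
    have hY' := hY ⟨i, hi⟩
    simp at hb hY'
    simp [hx, hI, h13', h2', h1, h2, h13, hn, hb, hY']
    have key : (∀ j : Fin n, (j : ℕ) ≤ i → j ∈ L[k] → j ∈ Y) ↔
        (∀ j : Fin n, (j : ℕ) < i → j ∈ L[k] → j ∈ Y) ∧
          ((⟨i, hi⟩ : Fin n) ∈ L[k] → (⟨i, hi⟩ : Fin n) ∈ Y) := by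
      refine ⟨fun h => ⟨fun j hj => h j (by omega), h _ (by simp)⟩, fun h j hj => ?_⟩
      rcases Nat.lt_or_eq_of_le hj with hj | hj
      · exact h.1 j hj
      · obtain rfl : j = ⟨i, hi⟩ := Fin.ext hj
        exact h.2
    simp only [key]
    split_ifs <;> simp_all
  · intro s' hf h
    refine Run.assign ?_
    have h11 := hf.var 11 rfl
    simp at h11
    have : (∀ j : Fin n, (j : ℕ) < n → j ∈ L[k] → j ∈ Y) ↔ L[k] ⊆ Y :=
      ⟨fun h j hj => h j j.2 hj, fun h j _ hj => h hj⟩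
    simp only [this] at h
    simp [h, h11]

/-- The support splits into listed and unlisted sets, so subtracting the listed part from the zeta
transform leaves the residual. -/
theorem zeta_eq_add_subsetSum (v : UnionAlgebra n) {L : List (Finset (Fin n))} (hL : L.Nodup)
    (hsub : L.toFinset ⊆ supp v) (Y : Finset (Fin n)) :
    (zeta Y v : ℤ) = subsetSum v (supp v \ L.toFinset) Y +
      (L.map fun X => if X ⊆ Y then (coord v X : ℤ) else 0).sum := by
  rw [← List.sum_toFinset _ hL, zeta_apply, subsetSum, Finset.sum_filter, Finset.sum_filter,
    ← Finset.sum_sdiff hsub]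
  push_cast
  rfl

theorem run_residual (hC : C.HasSingletonInputs) (hs : Loaded C s) (hY : HoldsSet Y s)
    {L : List (Finset (Fin n))} (hL : HoldsTable C.output L s) (hnd : L.Nodup)
    (hsub : L.toFinset ⊆ supp C.output) :
    Run residual s (residualTime C.encode.length L.length) fun s' =>
      s'.var 11 = (subsetSum C.output (supp C.output \ L.toFinset) Y : ℕ) := by
  refine Run.seq (run_evalCircuit hC hs hY) fun s₁ hf h11 => ?_
  have hL₁ := hL.frame hf rfl rfl rfl
  have hs₁ := hs.frame hf rfl rfl rfl rfl
  have hY₁ := hY.frame hf rfl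
  refine (Run.forLoop (K := L.length) (fun k s' => s'.var 11 = zeta Y C.output -
    ((L.take k).map fun X => if X ⊆ Y then (coord C.output X : ℤ) else 0).sum)
    rfl rfl (by decide) hL₁.count (by simp [h11]) ?_).imp ?_
  · intro k s₂ hk hx hf₂ hI
    refine (run_subtractEntry (n_le_length C) (by rw [hf₂.var 2 rfl, hs₁.n]) (hY₁.frame hf₂ rfl)
      (hL₁.frame hf₂ rfl rfl rfl) hk hx).imp ?_
    intro s' _ h
    rw [← List.take_append_getElem hk]
    simp [h, hI, -List.take_append_getElem, -List.map_take]
    ring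
  · intro s' _ h
    rw [h, List.take_length, zeta_eq_add_subsetSum _ hnd hsub]
    ring

/-- Makes `Y` the set of all elements. -/
def fillSet : Program := forLoop 15 2 (.write 2 (.var 15) (.const 1))

theorem run_fillSet {N : ℕ} (hN : n ≤ N) (hn : s.var 2 = n) :
    Run fillSet s (fillSet.time N) fun s' => HoldsSet (Finset.univ : Finset (Fin n)) s' := by
  refine (Run.forLoop_time (K := n) hN (fun k s' => ∀ j : ℕ, j < k → s'.arr 2 j = 1)
    rfl rfl (by decide) (by simp [hn]) (by simp) ?_).imp ?_
  · intro k s' hk hx hf hI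
    refine Run.write fun j hj => ?_
    simp only [State.setVar_arr, State.setArr_arr, if_true, Function.update_apply, Expr.eval, hx]
    split_ifs with h
    · rfl
    · exact hI j (by omega)
  · intro s' _ h j
    simpa using h j j.2

/-- Removes element number `var 17` from `Y` if this leaves a positive residual. -/
def tryRemove : Program :=
  .seq (.write 2 (.var 17) (.const 0)) <|
  .seq residual <|
  .ifPos (.var 11) (.assign 16 (.var 11)) (.write 2 (.var 17) (.const 1))

/-- Makes `Y` a minimal set with a positive residual, which is stored in variable `16`. -/
def minimizeSet : Program := forLoop 17 2 tryRemove

/-- Each element is tried once. Elements not yet tried are still in `Y`, and for every tried element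
that was kept, its deletion makes the residual zero. -/
theorem run_minimizeSet (hC : C.HasSingletonInputs) (hs : Loaded C s)
    (hY : HoldsSet (Finset.univ : Finset (Fin n)) s)
    {L : List (Finset (Fin n))} (hL : HoldsTable C.output L s) (hnd : L.Nodup)
    (hsub : L.toFinset ⊆ supp C.output)
    (h16 : s.var 16 = (subsetSum C.output (supp C.output \ L.toFinset) Finset.univ : ℕ))
    (hpos : 0 < s.var 16) :
    Run minimizeSet s (n * (residualTime C.encode.length L.length + 20) + 6) fun s' =>
      ∃ Y ∈ supp C.output \ L.toFinset, HoldsSet Y s' ∧ s'.var 16 = coord C.output Y := by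
  set S := supp C.output \ L.toFinset with hS
  refine ((Run.forLoop (K := n) (T := residualTime C.encode.length L.length + 12) (fun i s' =>
    ∃ Y : Finset (Fin n), HoldsSet Y s' ∧ s'.var 16 = (subsetSum C.output S Y : ℕ) ∧
      0 < s'.var 16 ∧ (∀ j : Fin n, i ≤ j → j ∈ Y) ∧
      ∀ j ∈ Y, (j : ℕ) < i → subsetSum C.output S (Y.erase j) = 0)
    rfl rfl (by decide) (by simp [hs.n]) ⟨_, hY, by simp [h16], by simpa using hpos, by simp, by simp⟩
      ?_)).imp ?_
  · rintro i s₁ hi hx hf ⟨Y, hY₁, h16₁, hpos₁, hall, hmin⟩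
    have hs₁ := hs.frame hf rfl rfl rfl rfl
    have hL₁ := hL.frame hf rfl rfl rfl
    refine Run.mono (T := 3 + (residualTime C.encode.length L.length + (2 + (2 + 3)))) ?_ (by omega)
    refine Run.write_seq (Run.seq (Q := fun s' =>
      s'.var 11 = (subsetSum C.output S (Y.erase ⟨i, hi⟩) : ℕ)) ?_ fun s₂ hf₂ h11 => ?_)
    · refine run_residual (s := s₁.setArr 2 ((Expr.var 17).eval s₁) 0) hC
        ⟨fun j => by simpa using hs₁.arr j, hs₁.n, hs₁.size, hs₁.out⟩ ?_
        ⟨hL₁.count, by simpa [State.HasOutput] using hL₁.output⟩ hnd hsub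
      intro j
      have := hY₁ j
      simp only [State.setArr_arr, if_true, Function.update_apply, Expr.eval, hx, Finset.mem_erase,
        Nat.cast_inj, ne_eq, Fin.ext_iff]
      split_ifs <;> simp_all
    · have hx₂ : s₂.var 17 = i := by simp [hf₂.var 17 rfl, hx]
      have ha₂ : s₂.arr 2 = Function.update (s₁.arr 2) i 0 := by simp [hf₂.arr 2 rfl, hx]
      have h16₂ : s₂.var 16 = s₁.var 16 := by simp [hf₂.var 16 rfl]
      refine Run.ifPos (fun hp => Run.assign ?_) fun hp => Run.write ?_
      · simp only [Expr.eval] at hp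
        refine ⟨Y.erase ⟨i, hi⟩, fun j => ?_, by simp [h11], by simpa using hp, ?_, ?_⟩
        · have := hY₁ j
          simp only [State.setVar_arr, ha₂, Function.update_apply, Finset.mem_erase,
            Nat.cast_inj, ne_eq, Fin.ext_iff]
          split_ifs <;> simp_all
        · intro j hj
          refine Finset.mem_erase.2 ⟨?_, hall j (by omega)⟩
          rintro rfl
          simp at hj
        · intro j hj hji
          rw [Finset.mem_erase, ne_eq, Fin.ext_iff] at hj
          have := hmin j hj.2 (by simp at hj; omega)
          -- Erasing `j` gave residual zero before, hence also now that `Y` has lost a further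
          -- element.
          have h' := subsetSum_mono C.output S (Finset.erase_subset_erase j (Finset.erase_subset ⟨i, hi⟩ Y))
          omega
      · simp only [Expr.eval, h11] at hp
        refine ⟨Y, fun j => ?_, by simp [h16₂, h16₁], by simpa [h16₂] using hpos₁,
          fun j hj => hall j (by omega), ?_⟩
        · have := hY₁ j
          have h2 := hall j
          simp only [State.setVar_arr, State.setArr_arr, ha₂, Function.update_apply, if_true, Expr.eval,
            hx₂, Nat.cast_inj]
          split_ifs with h3 h4
          · rfl
          -- Writing `1` back really restores `Y`, since an element not yet tried belongs to it.
          · exact absurd (h2 h3.ge) h4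
          · simp_all
          · simp_all
        · intro j hj hji
          rcases Nat.lt_or_eq_of_le (Nat.le_of_lt_succ hji) with h | h
          · exact hmin j hj h
          · obtain rfl : j = ⟨i, hi⟩ := Fin.ext h
            omega
  · rintro s' - ⟨Y, hY', h16', hpos', -, hmin⟩
    rw [h16'] at hpos'
    obtain ⟨hYS, hval⟩ := subsetSum_minimal (by exact_mod_cast hpos') fun j hj => hmin j hj j.2
    exact ⟨Y, hYS, hY', by rw [h16', hval]⟩

/-- Appends the set `Y` with value `var 16` to the table. -/
def appendEntry : Program :=
  .seq (forLoop 15 2 <| .write 1 (.var 1 + .var 15) (.read 2 (.var 15))) <|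
  .seq (.write 1 (.var 1 + .var 2) (.var 16)) <|
  .seq (.assign 1 (.var 1 + .var 2 + .const 1)) <|
  .assign 12 (.var 12 + .const 1)

theorem run_appendEntry {v : UnionAlgebra n} {L : List (Finset (Fin n))} {N : ℕ} (hN : n ≤ N)
    (hn : s.var 2 = n) (hY : HoldsSet Y s) (hL : HoldsTable v L s) (h16 : s.var 16 = coord v Y) :
    Run appendEntry s (appendEntry.time N) fun s' => HoldsTable v (L ++ [Y]) s' := by
  obtain ⟨hcount, hlen, hout⟩ := hL
  set l := encodeTable v L with hl
  refine Run.seq (Run.forLoop_time (K := n) hN (fun k s' =>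
    (∀ i < l.length, s'.arr 1 (i : ℕ) = l.getD i 0) ∧
    ∀ i < k, s'.arr 1 (l.length + i : ℕ) = (encodeSet Y).getD i 0)
    rfl rfl (by decide) (by simp [hn]) (by simpa using hout) ?_) ?_
  · rintro k s₁ hk hx hf ⟨hI, hI'⟩
    have h1 := hf.var 1 rfl
    have h2 := hf.arr 2 rfl
    have hYk := hY ⟨k, hk⟩
    rw [← encodeSet_getD] at hYk
    simp only at hYk
    refine Run.write ?_
    constructor
    · intro i hi
      rw [← hI i hi]
      simp only [State.setVar_arr, State.setArr_arr, if_true, Function.update_apply, Expr.eval,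
        h1, hlen, hx]
      rw [if_neg (by omega)]
    · intro i hi
      simp only [State.setVar_arr, State.setArr_arr, if_true, Function.update_apply, Expr.eval,
        h1, hlen, hx, h2, hYk]
      split_ifs with h
      · obtain rfl : i = k := by push_cast at h; omega
        rfl
      · exact hI' i (by push_cast at h; omega)
  · rintro s₁ hf ⟨hI, hI'⟩
    refine Run.write_seq (Run.assign_seq (Run.assign ⟨?_, ?_, ?_⟩))
    · simp [hf.var 12 rfl, hcount]
    · rw [encodeTable_concat, ← hl]
      simp [hf.var 1 rfl, hf.var 2 rfl, hlen, hn]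
      ring
    · intro i hi
      rw [encodeTable_concat, ← hl] at hi ⊢
      simp only [List.length_append, length_encodeSet, List.length_singleton] at hi
      simp only [State.setVar_arr, State.setArr_arr, if_true, Function.update_apply, Expr.eval,
        hf.var 1 rfl, hf.var 2 rfl, hlen, hn, hf.var 16 rfl, h16]
      rcases lt_or_ge i l.length with h | h
      · rw [if_neg (by omega), hI i h, List.getD_append _ _ _ _ h]
      · obtain ⟨j, rfl⟩ := Nat.exists_eq_add_of_le h
        rw [List.getD_append_right _ _ _ _ h, Nat.add_sub_cancel_left]
        rcases lt_or_ge j n with hj | hj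
        · rw [if_neg (by push_cast; omega), hI' j hj, List.getD_append _ _ _ _ (by simpa)]
        · obtain rfl : j = n := by omega
          rw [if_pos (by push_cast; ring), List.getD_append_right _ _ _ _ (by simp)]
          simp

/-- Reads the first three entries of the input. -/
def load : Program :=
  .seq (.assign 2 (.read 0 (.const 0))) <|
  .seq (.assign 3 (.read 0 (.const 1))) <|
  .assign 4 (.read 0 (.const 2))

theorem run_load (C : Circuit (UnionAlgebra n)) :
    Run load (State.start C.encode) 9 fun s => Loaded C s := by
  refine Run.assign_seq (Run.assign_seq (Run.assign ⟨fun j => ?_, ?_, ?_, ?_⟩)) <;>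
    simp [State.start, Circuit.encode]

/-- Adds one more set to the table. -/
def listStep : Program :=
  .seq (.assign 16 (.var 11)) <| .seq minimizeSet <| .seq appendEntry <| .seq fillSet residual

/-- A bound on the running time of `listStep` for a table with fewer than `M` entries. -/
def listStepTime (N M : ℕ) : ℕ :=
  2 + ((N * (residualTime N M + 20) + 6) + (appendEntry.time N + (fillSet.time N + residualTime N M)))

theorem residualTime_mono (N : ℕ) {M M' : ℕ} (h : M ≤ M') : residualTime N M ≤ residualTime N M' := by
  unfold residualTime
  gcongr

/-- The state of the listing after the sets in `L` have been found. -/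
structure Listing (C : Circuit (UnionAlgebra n)) (L : List (Finset (Fin n))) (s : State) : Prop where
  nodup : L.Nodup
  subset : L.toFinset ⊆ supp C.output
  loaded : Loaded C s
  holdsSet : HoldsSet (Finset.univ : Finset (Fin n)) s
  table : HoldsTable C.output L s
  value : s.var 11 = (subsetSum C.output (supp C.output \ L.toFinset) Finset.univ : ℕ)

theorem Listing.length_le {L : List (Finset (Fin n))} (h : Listing C L s) :
    L.length ≤ (supp C.output).card := by
  rw [← List.toFinset_card_of_nodup h.nodup]
  exact Finset.card_le_card h.subset

theorem run_listStep (hC : C.HasSingletonInputs) {L : List (Finset (Fin n))} (h : Listing C L s)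
    (hpos : 0 < s.var 11) :
    Run listStep s (listStepTime C.encode.length (supp C.output).card) fun s' =>
      ∃ Y ∈ supp C.output \ L.toFinset, Listing C (L ++ [Y]) s' := by
  have hf₀ := (Exec.assign s 16 (.var 11)).frame
  have hs₀ := h.loaded.frame hf₀ rfl rfl rfl rfl
  have hL₀ := h.table.frame hf₀ rfl rfl rfl
  refine Run.assign_seq (Run.seq ((run_minimizeSet hC hs₀ (h.holdsSet.frame hf₀ rfl)
    hL₀ h.nodup h.subset (by simpa using h.value) (by simpa using hpos)).mono ?_) ?_)
  · gcongr
    · exact n_le_length C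
    · exact residualTime_mono _ h.length_le
  rintro t₁ hf₁ ⟨Y, hYS, hY₁, h16⟩
  have ht₁ := hs₀.frame hf₁ rfl rfl rfl rfl
  have hL₁ := hL₀.frame hf₁ rfl rfl rfl
  refine Run.seq (run_appendEntry (n_le_length C) ht₁.n hY₁ hL₁ h16) fun t₂ hf₂ hL₂ => ?_
  have ht₂ := ht₁.frame hf₂ rfl rfl rfl rfl
  refine Run.seq (run_fillSet (n_le_length C) ht₂.n) fun t₃ hf₃ hY₃ => ?_
  have ht₃ := ht₂.frame hf₃ rfl rfl rfl rfl
  have hL₃ := hL₂.frame hf₃ rfl rfl rfl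
  have hYm := Finset.mem_sdiff.1 hYS
  have hnd : (L ++ [Y]).Nodup := by
    refine List.nodup_append.2 ⟨h.nodup, List.nodup_singleton Y, ?_⟩
    rintro X hX X' hX' rfl
    obtain rfl := List.mem_singleton.1 hX'
    exact hYm.2 (List.mem_toFinset.2 hX)
  have hsub : (L ++ [Y]).toFinset ⊆ supp C.output := by
    rw [List.toFinset_append, Finset.union_subset_iff]
    simpa using ⟨h.subset, hYm.1⟩
  refine ((run_residual hC ht₃ hY₃ hL₃ hnd hsub).mono (residualTime_mono _ ?_)).imp fun t₄ hf₄ h11 => ?_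
  · rw [← List.toFinset_card_of_nodup hnd]
    exact Finset.card_le_card hsub
  · exact ⟨Y, hYS, hnd, hsub, ht₃.frame hf₄ rfl rfl rfl rfl, hY₃.frame hf₄ rfl,
      hL₃.frame hf₄ rfl rfl rfl, h11⟩

/-- Lists the support of the output of the circuit, together with its coordinates. -/
def listSupport : Program :=
  .seq load <| .seq fillSet <| .seq residual <| .whilePos (.var 11) listStep

/-- A bound on the running time of `listSupport` for a support of size `M`. -/
def listSupportTime (N M : ℕ) : ℕ :=
  9 + (fillSet.time N + (residualTime N 0 + (M * (listStepTime N M + 1 + 1) + (1 + 1))))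

theorem run_listSupport (hC : C.HasSingletonInputs) :
    Run listSupport (State.start C.encode) (listSupportTime C.encode.length (supp C.output).card)
      fun s => ∃ L : List (Finset (Fin n)), L.Nodup ∧ (∀ X, X ∈ L ↔ X ∈ supp C.output) ∧
        s.HasOutput (encodeTable C.output L) := by
  refine Run.seq (run_load C) fun s₁ hf₁ hs₁ => ?_
  have hL₁ : HoldsTable C.output [] s₁ := by
    refine ⟨by simp [hf₁.var 12 rfl, State.start], by simp [hf₁.var 1 rfl, State.start, encodeTable], ?_⟩
    simp [encodeTable]
  refine Run.seq (run_fillSet (n_le_length C) hs₁.n) fun s₂ hf₂ hY₂ => ?_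
  have hs₂ := hs₁.frame hf₂ rfl rfl rfl rfl
  have hL₂ := hL₁.frame hf₂ rfl rfl rfl
  have hres := run_residual hC hs₂ hY₂ hL₂ List.nodup_nil (by simp)
  refine Run.seq hres fun s₃ hf₃ h11 => ?_
  -- The number of unlisted support sets bounds the remaining rounds. A positive residual at `U`
  -- shows that one is left; a zero residual shows that the list is complete.
  refine (Run.whilePos (fun k s => ∃ L, Listing C L s ∧ (supp C.output \ L.toFinset).card = k)
    ⟨[], ⟨List.nodup_nil, by simp, hs₂.frame hf₃ rfl rfl rfl rfl, hY₂.frame hf₃ rfl,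
      hL₂.frame hf₃ rfl rfl rfl, h11⟩, by simp⟩ ?_).imp ?_
  · rintro k s ⟨L, h, rfl⟩ hpos
    refine ⟨(supp C.output \ L.toFinset).card - 1, ?_, (run_listStep hC h hpos).imp ?_⟩
    · have : (supp C.output \ L.toFinset).card ≠ 0 := fun h0 => by
        rw [Finset.card_eq_zero] at h0
        simp [h.value, h0, subsetSum] at hpos
      omega
    · rintro s' - ⟨Y, hY, h'⟩
      refine ⟨_, h', ?_⟩
      rw [← Finset.card_erase_of_mem hY, List.toFinset_append]
      congr 1
      ext X
      simp
      tauto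
  · rintro s' - ⟨h0, k, L, h, -⟩
    refine ⟨L, h.nodup, fun X => ⟨fun hX => h.subset (List.mem_toFinset.2 hX), fun hX => ?_⟩,
      h.table.output⟩
    by_contra hXL
    simp only [Expr.eval, h.value] at h0
    have h0' : subsetSum C.output (supp C.output \ L.toFinset) Finset.univ = 0 := by omega
    exact mem_supp.1 hX (Finset.sum_eq_zero_iff.1 h0' X (by simp [hX, hXL]))

end UnionCircuit

namespace UnionCircuit

/-! ### Sets as binary numbers -/

/-- The set of the binary digits of `k`. -/
def bitSet (n k : ℕ) : Finset (Fin n) := Finset.univ.filter fun d => k.testBit d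

/-- Every binary digit of `a` is one of `b`. -/
def BitSub (a b : ℕ) : Prop := ∀ d, a.testBit d → b.testBit d

theorem mem_bitSet {n k : ℕ} {d : Fin n} : d ∈ bitSet n k ↔ k.testBit d := by simp [bitSet]

/-- Only `a` needs a bound: `bitSet` forgets digits from `n` on, and those of `b` are irrelevant
when `a` has none. -/
theorem bitSet_subset {n a : ℕ} (ha : a < 2 ^ n) (b : ℕ) : bitSet n a ⊆ bitSet n b ↔ BitSub a b := by
  refine ⟨fun h d hd => ?_, fun h d hd => mem_bitSet.2 (h d (mem_bitSet.1 hd))⟩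
  have hdn : d < n := by
    by_contra hdn
    have : a < 2 ^ d := ha.trans_le (Nat.pow_le_pow_right (by norm_num) (by omega))
    simp [Nat.testBit_lt_two_pow this] at hd
  exact mem_bitSet.1 (h (mem_bitSet (d := ⟨d, hdn⟩).2 hd))

theorem BitSub.antisymm {a b : ℕ} (h : BitSub a b) (h' : BitSub b a) : a = b :=
  Nat.eq_of_testBit_eq fun d => Bool.eq_iff_iff.2 ⟨h d, h' d⟩

theorem BitSub.le {a b : ℕ} (h : BitSub a b) : a ≤ b := by
  have : a ||| b = b := Nat.eq_of_testBit_eq fun d => by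
    have := h d
    simp only [Nat.testBit_or]
    cases ha : a.testBit d <;> simp_all
  rw [← this]
  exact Nat.left_le_or

theorem bitSet_injOn (n : ℕ) : Set.InjOn (bitSet n) (Finset.range (2 ^ n)) := by
  intro a ha b hb h
  simp only [Finset.coe_range, Set.mem_Iio] at ha hb
  exact ((bitSet_subset ha b).1 h.le).antisymm ((bitSet_subset hb a).1 h.ge)

theorem image_bitSet (n : ℕ) : (Finset.range (2 ^ n)).image (bitSet n) = Finset.univ := by
  refine Finset.eq_univ_of_card _ ?_
  rw [Finset.card_image_of_injOn (bitSet_injOn n)]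
  simp

theorem sum_bitSet {n : ℕ} (f : Finset (Fin n) → ℕ) :
    ∑ X, f X = ∑ k ∈ Finset.range (2 ^ n), f (bitSet n k) := by
  rw [← image_bitSet, Finset.sum_image (bitSet_injOn n)]

/-- The coordinate of `v` at the set with the binary digits of `k`. -/
def bitCoord {n : ℕ} (v : UnionAlgebra n) (k : ℕ) : ℕ := coord v (bitSet n k)

open Classical in
theorem zeta_bitSet {n : ℕ} (v : UnionAlgebra n) (k : ℕ) : zeta (bitSet n k) v =
    ∑ k' ∈ Finset.range (2 ^ n), if BitSub k' k then bitCoord v k' else 0 := by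
  have h : zeta (bitSet n k) v = ∑ X, if X ⊆ bitSet n k then coord v X else 0 := by
    rw [zeta_apply, Finset.sum_filter]
    refine Finset.sum_subset (Finset.subset_univ _) fun X _ hX => ?_
    rw [mem_supp, not_not] at hX
    simp [hX]
  rw [h, sum_bitSet]
  refine Finset.sum_congr rfl fun k' hk' => ?_
  simp only [bitSet_subset (Finset.mem_range.1 hk')]
  rfl

theorem sum_range_two_pow_add {M : Type*} [AddCommMonoid M] (i q : ℕ) (f : ℕ → M) :
    ∑ k ∈ Finset.range (2 ^ (i + q)), f k =
      ∑ X ∈ Finset.range (2 ^ i), ∑ Z ∈ Finset.range (2 ^ q), f (2 ^ i * Z + X) := by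
  have h : ∀ a m : ℕ, ∑ k ∈ Finset.range (a * m), f k =
      ∑ Z ∈ Finset.range m, ∑ X ∈ Finset.range a, f (a * Z + X) := by
    intro a m
    induction m with
    | zero => simp
    | succ m ih => rw [Nat.mul_succ, Finset.sum_range_add, ih, Finset.sum_range_succ]
  rw [pow_add, h, Finset.sum_comm]

theorem bitSub_mul_add {i X X' : ℕ} (hX : X < 2 ^ i) (hX' : X' < 2 ^ i) (Z Z' : ℕ) :
    BitSub (2 ^ i * Z' + X') (2 ^ i * Z + X) ↔ BitSub X' X ∧ BitSub Z' Z := by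
  simp only [BitSub, Nat.testBit_two_pow_mul_add _ hX, Nat.testBit_two_pow_mul_add _ hX']
  refine ⟨fun h => ⟨fun d hd => ?_, fun d hd => ?_⟩, fun h d hd => ?_⟩
  · have hdi : d < i := by
      by_contra hdn
      have : X' < 2 ^ d := hX'.trans_le (Nat.pow_le_pow_right (by norm_num) (by omega))
      simp [Nat.testBit_lt_two_pow this] at hd
    simpa [hdi, hd] using h d
  · simpa [hd] using h (i + d)
  · split_ifs at hd ⊢
    · exact h.1 d hd
    · exact h.2 _ hd

/-- The sign `(-1) ^ (number of the digits of k below q that vanish)`. -/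
def bitSign (q k : ℕ) : ℤ := ∏ j ∈ Finset.range q, if k.testBit j then 1 else -1

theorem bitSign_mul_self (q k : ℕ) : bitSign q k * bitSign q k = 1 := by
  rw [bitSign, ← Finset.prod_mul_distrib]
  exact Finset.prod_eq_one fun j _ => by split_ifs <;> rfl

theorem bitSign_mul_add {i X : ℕ} (hX : X < 2 ^ i) (q Z : ℕ) :
    bitSign (i + q) (2 ^ i * Z + X) = bitSign i X * bitSign q Z := by
  rw [bitSign, Finset.prod_range_add]
  congr 1
  · refine Finset.prod_congr rfl fun j hj => ?_
    rw [Nat.testBit_two_pow_mul_add _ hX, if_pos (Finset.mem_range.1 hj)]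
  · refine Finset.prod_congr rfl fun j hj => ?_
    rw [Nat.testBit_two_pow_mul_add _ hX, if_neg (show ¬ i + j < i by omega), Nat.add_sub_cancel_left]

theorem bitSign_full (q : ℕ) : bitSign q (2 ^ q - 1) = 1 :=
  Finset.prod_eq_one fun j hj => by simp [Nat.testBit_two_pow_sub_one, Finset.mem_range.1 hj]

/-- Distributivity: expanding the product chooses one of two terms for each digit, and the choices
are the `q`-digit numbers. -/
theorem sum_prod_testBit (q : ℕ) (c : ℕ → Bool → ℤ) :
    ∑ Z ∈ Finset.range (2 ^ q), ∏ j ∈ Finset.range q, c j (Z.testBit j) =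
      ∏ j ∈ Finset.range q, (c j false + c j true) := by
  induction q with
  | zero => simp
  | succ q ih =>
    have h : ∀ X ∈ Finset.range (2 ^ q), ∀ Z < 2, ∏ j ∈ Finset.range (q + 1), c j ((2 ^ q * Z + X).testBit j)
        = (∏ j ∈ Finset.range q, c j (X.testBit j)) * c q (Z.testBit 0) := by
      intro X hX Z _
      rw [Finset.prod_range_succ, Nat.testBit_two_pow_mul_add _ (Finset.mem_range.1 hX)]
      simp only [lt_irrefl, if_false, Nat.sub_self]
      congr 1
      refine Finset.prod_congr rfl fun j hj => ?_
      rw [Nat.testBit_two_pow_mul_add _ (Finset.mem_range.1 hX), if_pos (Finset.mem_range.1 hj)]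
    rw [sum_range_two_pow_add q 1, Finset.prod_range_succ, ← ih, Finset.sum_mul]
    refine Finset.sum_congr rfl fun X hX => ?_
    rw [show 2 ^ 1 = 2 from rfl, Finset.sum_range_succ, Finset.sum_range_one, h X hX 0 (by norm_num),
      h X hX 1 (by norm_num)]
    simp [mul_add]

-- Möbius inversion at the top set: every digit missing from `Z'` may be present or absent in `Z`,
-- with opposite signs, and cancels.
open Classical in
theorem sum_bitSign (q : ℕ) {Z' : ℕ} (hZ' : Z' < 2 ^ q) :
    ∑ Z ∈ Finset.range (2 ^ q), bitSign q Z * (if BitSub Z' Z then 1 else 0) =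
      if Z' = 2 ^ q - 1 then 1 else 0 := by
  have hlow : ∀ d, Z'.testBit d → d < q := fun d hd => by
    by_contra hdn
    have : Z' < 2 ^ d := hZ'.trans_le (Nat.pow_le_pow_right (by norm_num) (by omega))
    simp [Nat.testBit_lt_two_pow this] at hd
  -- The contribution of digit `j` is its sign times the condition that `Z'` does not exceed `Z`
  -- there; the two cases add up to the indicator of digit `j` of `Z'`.
  set c : ℕ → Bool → ℤ := fun j b =>
    (if b then 1 else -1) * if Z'.testBit j → b then 1 else 0 with hc
  have h : ∀ Z, bitSign q Z * (if BitSub Z' Z then 1 else 0) =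
      ∏ j ∈ Finset.range q, c j (Z.testBit j) := by
    intro Z
    have : BitSub Z' Z ↔ ∀ j ∈ Finset.range q, Z'.testBit j → Z.testBit j :=
      ⟨fun h j _ => h j, fun h d hd => h d (Finset.mem_range.2 (hlow d hd)) hd⟩
    simp only [hc]
    rw [Finset.prod_mul_distrib, Finset.prod_ite_zero, bitSign, Finset.prod_const_one]
    simp only [this]
  have h' : ∀ j, c j false + c j true = if Z'.testBit j then 1 else 0 := fun j => by
    cases hj : Z'.testBit j <;> simp [hc, hj]
  have h'' : (∀ j ∈ Finset.range q, Z'.testBit j) ↔ Z' = 2 ^ q - 1 := by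
    refine ⟨fun h => Nat.eq_of_testBit_eq fun d => ?_, fun h j hj => ?_⟩
    · rw [Nat.testBit_two_pow_sub_one, Bool.eq_iff_iff, decide_eq_true_eq]
      exact ⟨hlow d, fun hd => h d (Finset.mem_range.2 hd)⟩
    · rw [h, Nat.testBit_two_pow_sub_one]
      simpa using hj
  rw [Finset.sum_congr rfl fun Z _ => h Z, sum_prod_testBit, Finset.prod_congr rfl fun j _ => h' j,
    Finset.prod_ite_zero, Finset.prod_const_one]
  simp only [h'']

/-! ### The online Möbius transform -/

open Classical in
/-- The sum of `f` over the subsets of `X` that agree with `X` on the digits from `d` on. -/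
noncomputable def partialSum (f : ℕ → ℤ) (d X : ℕ) : ℤ :=
  ∑ X' ∈ Finset.range (X + 1) with BitSub X' X ∧ ∀ j, d ≤ j → X'.testBit j = X.testBit j, f X'

theorem partialSum_zero (f : ℕ → ℤ) (X : ℕ) : partialSum f 0 X = f X := by
  classical
  refine Finset.sum_eq_single_of_mem X
    (Finset.mem_filter.2 ⟨by simp, fun _ h => h, fun _ _ => rfl⟩) fun X' hX' hne => ?_
  simp only [Finset.mem_filter] at hX'
  exact absurd (Nat.eq_of_testBit_eq fun j => hX'.2.2 j (by omega)) hne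

theorem testBit_sub_two_pow {X d : ℕ} (h : X.testBit d) (j : ℕ) :
    (X - 2 ^ d).testBit j = (X.testBit j && decide (j ≠ d)) := by
  have hpos := Nat.two_pow_pos d
  have hb : X % 2 ^ d < 2 ^ d := Nat.mod_lt _ hpos
  -- Splits `X` into the part above digit `d`, the digit itself, and the part below; subtraction
  -- removes the middle block without a borrow.
  have hX : X = 2 ^ (d + 1) * (X / 2 ^ (d + 1)) + (2 ^ d + X % 2 ^ d) := by
    have h1 := Nat.div_add_mod X (2 ^ (d + 1))
    rw [Nat.mod_pow_succ] at h1
    rw [Nat.testBit_eq_decide_div_mod_eq, decide_eq_true_eq] at h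
    rw [h] at h1
    omega
  generalize X / 2 ^ (d + 1) = a at hX
  generalize X % 2 ^ d = b at hX hb
  subst hX
  have hs : 2 ^ (d + 1) * a + (2 ^ d + b) - 2 ^ d = 2 ^ (d + 1) * a + b := by omega
  rw [hs, Nat.testBit_two_pow_mul_add _ (by rw [pow_succ]; omega),
    Nat.testBit_two_pow_mul_add _ (by rw [pow_succ]; omega)]
  split_ifs with hj
  · rcases Nat.lt_or_eq_of_le (Nat.le_of_lt_succ hj) with hj | rfl
    · simp [Nat.testBit_two_pow_add_gt hj, hj.ne]
    · simp [Nat.testBit_lt_two_pow hb]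
  · simp [show j ≠ d by omega]

/-- The Yates recursion. Subsets that keep digit `d` form the first sum; those that drop it are
subsets of `X` without that digit. -/
theorem partialSum_succ_of_testBit (f : ℕ → ℤ) {d X : ℕ} (h : X.testBit d) :
    partialSum f (d + 1) X = partialSum f d X + partialSum f d (X - 2 ^ d) := by
  classical
  have hle : X - 2 ^ d < X := by
    have := Nat.ge_two_pow_of_testBit h
    have := Nat.two_pow_pos d
    omega
  have hb := testBit_sub_two_pow h
  unfold partialSum
  rw [← Finset.sum_union]
  · congr 1
    ext X'
    simp only [Finset.mem_union, Finset.mem_filter, Finset.mem_range, Nat.lt_succ_iff]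
    constructor
    · rintro ⟨h1, h2, h3⟩
      by_cases hd : X'.testBit d
      · refine Or.inl ⟨h1, h2, fun j hj => ?_⟩
        rcases Nat.lt_or_eq_of_le hj with hj | rfl
        · exact h3 j hj
        · rw [hd, h]
      · have hs : BitSub X' (X - 2 ^ d) := fun j hj => by
          rw [hb, h2 j hj]
          have : j ≠ d := by rintro rfl; exact hd hj
          simp [this]
        refine Or.inr ⟨hs.le, hs, fun j hj => ?_⟩
        rw [hb]
        rcases Nat.lt_or_eq_of_le hj with hj | rfl
        · simp [h3 j hj, hj.ne']
        · simpa using hd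
    · rintro (⟨h1, h2, h3⟩ | ⟨h1, h2, h3⟩)
      · exact ⟨h1, h2, fun j hj => h3 j (by omega)⟩
      · refine ⟨by omega, fun j hj => ?_, fun j hj => ?_⟩
        · have := h2 j hj
          rw [hb] at this
          simp at this
          exact this.1
        · rw [h3 j (by omega), hb]
          simp [show j ≠ d by omega]
  · rw [Finset.disjoint_left]
    intro X' h1 h2
    simp only [Finset.mem_filter] at h1 h2
    have h3 := h1.2.2 d le_rfl
    have h4 := h2.2.2 d le_rfl
    rw [hb] at h4
    simp [h4, h] at h3

theorem partialSum_succ_of_not_testBit (f : ℕ → ℤ) {d X : ℕ} (h : X.testBit d = false) :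
    partialSum f (d + 1) X = partialSum f d X := by
  unfold partialSum
  congr 1
  ext X'
  simp only [Finset.mem_filter]
  refine and_congr_right fun _ => and_congr_right fun h2 => ⟨fun h3 j hj => ?_, fun h3 j hj => h3 j (by omega)⟩
  rcases Nat.lt_or_eq_of_le hj with hj | rfl
  · exact h3 j hj
  · have := h2 d
    cases hd : X'.testBit d <;> simp_all

-- From digit `i` on, neither number has a digit, so the agreement condition is void and the partial
-- sum is the full zeta transform.
open Classical in
theorem partialSum_of_lt (f : ℕ → ℤ) {i X : ℕ} (hX : X < 2 ^ i) :
    partialSum f i X = ∑ X' ∈ Finset.range (2 ^ i), if BitSub X' X then f X' else 0 := by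
  rw [← Finset.sum_filter, partialSum]
  congr 1
  ext X'
  simp only [Finset.mem_filter, Finset.mem_range, Nat.lt_succ_iff]
  constructor
  · rintro ⟨h1, h2, -⟩
    exact ⟨by omega, h2⟩
  · rintro ⟨h1, h2⟩
    refine ⟨h2.le, h2, fun j hj => ?_⟩
    rw [Nat.testBit_lt_two_pow (hX.trans_le (Nat.pow_le_pow_right (by norm_num) hj)),
      Nat.testBit_lt_two_pow (h1.trans_le (Nat.pow_le_pow_right (by norm_num) hj))]

/-! ### Splitting the ground set -/

/-- The sum of the coordinates at the sets with lowest `i` digits `X`. -/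
def lowSum {n : ℕ} (v : UnionAlgebra n) (i X : ℕ) : ℕ :=
  ∑ Z ∈ Finset.range (2 ^ (n - i)), bitCoord v (2 ^ i * Z + X)

/-- The coordinate at the set with lowest `i` digits `X` that contains all other elements. -/
def topCoord {n : ℕ} (v : UnionAlgebra n) (i X : ℕ) : ℕ :=
  bitCoord v (2 ^ i * (2 ^ (n - i) - 1) + X)

theorem bitSub_full {q Z : ℕ} (h : Z < 2 ^ q) : BitSub Z (2 ^ q - 1) := by
  intro d hd
  rw [Nat.testBit_two_pow_sub_one, decide_eq_true_eq]
  by_contra hdn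
  have : Z < 2 ^ d := h.trans_le (Nat.pow_le_pow_right (by norm_num) (by omega))
  simp [Nat.testBit_lt_two_pow this] at hd

variable {n : ℕ} (v : UnionAlgebra n) {i X : ℕ}

-- Inclusion is tested separately on the low and the high digits, so the zeta transform factors into
-- one over each part of the ground set.
open Classical in
theorem zeta_mul_add (hi : i ≤ n) (hX : X < 2 ^ i) (Z : ℕ) :
    zeta (bitSet n (2 ^ i * Z + X)) v = ∑ X' ∈ Finset.range (2 ^ i), if BitSub X' X then
      ∑ Z' ∈ Finset.range (2 ^ (n - i)), if BitSub Z' Z then bitCoord v (2 ^ i * Z' + X') else 0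
      else 0 := by
  have h := zeta_bitSet v (2 ^ i * Z + X)
  rw [show 2 ^ n = 2 ^ (i + (n - i)) by rw [Nat.add_sub_cancel' hi], sum_range_two_pow_add] at h
  rw [h]
  refine Finset.sum_congr rfl fun X' hX' => ?_
  simp only [bitSub_mul_add hX (Finset.mem_range.1 hX')]
  split_ifs with h <;> simp [h]

/-- With all upper elements present there is no restriction on the upper part, and the inner sum
collapses to `lowSum`. One query thus gives one value of the transform of `lowSum`. -/
theorem zeta_full_mul_add (hi : i ≤ n) (hX : X < 2 ^ i) :
    (zeta (bitSet n (2 ^ i * (2 ^ (n - i) - 1) + X)) v : ℤ) =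
      partialSum (fun X => lowSum v i X) i X := by
  classical
  rw [partialSum_of_lt _ hX, zeta_mul_add v hi hX]
  push_cast
  refine Finset.sum_congr rfl fun X' _ => ?_
  split_ifs with h
  · simp only [lowSum]
    push_cast
    refine Finset.sum_congr rfl fun Z' hZ' => ?_
    rw [if_pos (bitSub_full (Finset.mem_range.1 hZ'))]
  · rfl

/-- Möbius inversion on the upper part only: by `sum_bitSign` the signs retain just the sets that
contain every upper element, and the low part remains zeta transformed. -/
theorem sum_bitSign_zeta (hi : i ≤ n) (hX : X < 2 ^ i) :
    ∑ Z ∈ Finset.range (2 ^ (n - i)), bitSign (n - i) Z * zeta (bitSet n (2 ^ i * Z + X)) v =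
      partialSum (fun X => topCoord v i X) i X := by
  classical
  rw [partialSum_of_lt _ hX]
  simp only [zeta_mul_add v hi hX]
  push_cast
  simp only [Finset.mul_sum]
  rw [Finset.sum_comm]
  refine Finset.sum_congr rfl fun X' _ => ?_
  split_ifs with h
  · simp only [Finset.mul_sum]
    rw [Finset.sum_comm]
    have : ∀ Z' ∈ Finset.range (2 ^ (n - i)), (∑ Z ∈ Finset.range (2 ^ (n - i)),
        bitSign (n - i) Z * if BitSub Z' Z then (bitCoord v (2 ^ i * Z' + X') : ℤ) else 0) =
        if Z' = 2 ^ (n - i) - 1 then (bitCoord v (2 ^ i * Z' + X') : ℤ) else 0 := by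
      intro Z' hZ'
      have h := congrArg (· * (bitCoord v (2 ^ i * Z' + X') : ℤ)) (sum_bitSign (n - i) (Finset.mem_range.1 hZ'))
      simp only [Finset.sum_mul, mul_assoc, ite_mul, one_mul, zero_mul] at h
      exact h
    rw [Finset.sum_congr rfl this, Finset.sum_ite_eq', if_pos]
    · rfl
    · have := Nat.two_pow_pos (n - i)
      simp
  · simp

/-- A vanishing sum of natural numbers has only zero terms. This is where nonnegativity saves the
expensive alternating sums. -/
theorem topCoord_eq_zero (hX : lowSum v i X = 0) : topCoord v i X = 0 := by
  have := Nat.two_pow_pos (n - i)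
  exact Finset.sum_eq_zero_iff.1 hX _ (by simp)

theorem topCoord_full (hi : i ≤ n) : topCoord v i (2 ^ i - 1) = coord v Finset.univ := by
  rw [topCoord, bitCoord]
  congr 1
  have h1 := Nat.two_pow_pos i
  ext d
  simp only [mem_bitSet, Finset.mem_univ, iff_true]
  rw [Nat.testBit_two_pow_mul_add _ (by omega), Nat.testBit_two_pow_sub_one, Nat.testBit_two_pow_sub_one]
  have := d.2
  split_ifs <;> simp <;> omega

/-- The number of non-zero values of `lowSum`. -/
def lowCount (i : ℕ) : ℕ := ((Finset.range (2 ^ i)).filter fun X => 0 < lowSum v i X).card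

theorem lowCount_le_two_pow (i : ℕ) : lowCount v i ≤ 2 ^ i :=
  (Finset.card_filter_le _ _).trans_eq (Finset.card_range _)

/-- A low part with positive `lowSum` extends to a set in the support; it is recovered from the
number of that set modulo `2 ^ i`. -/
theorem lowCount_le_card_supp (hi : i ≤ n) : lowCount v i ≤ (supp v).card := by
  have h : (supp v).card = ((Finset.range (2 ^ n)).filter fun k => bitCoord v k ≠ 0).card := by
    rw [← Finset.card_image_of_injOn ((bitSet_injOn n).mono (Finset.coe_subset.2 (Finset.filter_subset _ _)))]
    congr 1
    ext X
    have := Finset.mem_univ X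
    rw [← image_bitSet, Finset.mem_image] at this
    obtain ⟨k, hk, rfl⟩ := this
    rw [mem_supp]
    refine ⟨fun h => Finset.mem_image_of_mem _ (Finset.mem_filter.2 ⟨hk, h⟩), fun h => ?_⟩
    obtain ⟨k', hk', h'⟩ := Finset.mem_image.1 h
    rw [← h']
    exact (Finset.mem_filter.1 hk').2
  rw [h]
  refine (Finset.card_le_card (t := (((Finset.range (2 ^ n)).filter fun k => bitCoord v k ≠ 0).image
    (· % 2 ^ i))) fun X hX => ?_).trans Finset.card_image_le
  rw [Finset.mem_filter, Finset.mem_range] at hX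
  obtain ⟨Z, hZ, h0⟩ := Finset.exists_ne_zero_of_sum_ne_zero hX.2.ne'
  refine Finset.mem_image.2 ⟨2 ^ i * Z + X, Finset.mem_filter.2 ⟨?_, h0⟩, ?_⟩
  · rw [Finset.mem_range] at hZ ⊢
    calc 2 ^ i * Z + X < 2 ^ i * (Z + 1) := by rw [mul_add]; omega
      _ ≤ 2 ^ i * 2 ^ (n - i) := Nat.mul_le_mul_left _ hZ
      _ = 2 ^ n := by rw [← pow_add, Nat.add_sub_cancel' hi]
  · show (2 ^ i * Z + X) % 2 ^ i = X
    rw [Nat.mul_add_mod, Nat.mod_eq_of_lt hX.1]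

/-- Splitting off the lowest `i` elements is balanced. -/
def Balanced (i : ℕ) : Prop := lowCount v i * 2 ^ (n - i) ≤ 2 ^ i

/-- Guarantees that the search for a balanced split succeeds at `i = n` at the latest. -/
theorem balanced_self : Balanced v n := by
  simpa [Balanced] using lowCount_le_two_pow v n

-- The integer `⌈(1 - α / 2) n⌉` gives a balanced split, so the least balanced one is no larger.
-- Rounding up costs the factor `2`.
open Classical in
theorem two_pow_find_balanced_le {α : ℝ} (h0 : 0 < α) (h1 : α ≤ 1 / 2)
    (h : ((supp v).card : ℝ) ≤ (2 : ℝ) ^ ((1 - α) * (n : ℝ))) :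
    (2 : ℝ) ^ Nat.find ⟨n, balanced_self v⟩ ≤ 2 * (2 : ℝ) ^ ((1 - α / 2) * (n : ℝ)) := by
  set i := ⌈(1 - α / 2) * (n : ℝ)⌉₊ with hi
  have hn : (0 : ℝ) ≤ n := n.cast_nonneg
  have hin : i ≤ n := by
    rw [hi, Nat.ceil_le]
    nlinarith
  have hle : (1 - α / 2) * (n : ℝ) ≤ i := Nat.le_ceil _
  have hlt : (i : ℝ) < (1 - α / 2) * (n : ℝ) + 1 := Nat.ceil_lt_add_one (by nlinarith)
  have hb : Balanced v i := by
    have h2 : (lowCount v i : ℝ) ≤ (2 : ℝ) ^ ((1 - α) * (n : ℝ)) :=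
      le_trans (by exact_mod_cast lowCount_le_card_supp v hin) h
    have h3 : (lowCount v i : ℝ) * 2 ^ (n - i) ≤ 2 ^ i := by
      calc (lowCount v i : ℝ) * 2 ^ (n - i) ≤ (2 : ℝ) ^ ((1 - α) * (n : ℝ)) * 2 ^ (n - i) := by gcongr
        _ = (2 : ℝ) ^ ((1 - α) * (n : ℝ) + (n - i : ℝ)) := by
          rw [Real.rpow_add (by norm_num), ← Nat.cast_sub hin, Real.rpow_natCast]
        -- Compares exponents: `(1 - α) n + (n - i) ≤ i` says `(2 - α) n ≤ 2 i`.
        _ ≤ (2 : ℝ) ^ (i : ℝ) := Real.rpow_le_rpow_of_exponent_le (by norm_num) (by nlinarith)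
        _ = 2 ^ i := Real.rpow_natCast _ _
    exact_mod_cast h3
  calc (2 : ℝ) ^ Nat.find ⟨n, balanced_self v⟩ ≤ (2 : ℝ) ^ i :=
        pow_le_pow_right₀ (by norm_num) (Nat.find_min' _ hb)
    _ = (2 : ℝ) ^ (i : ℝ) := (Real.rpow_natCast _ _).symm
    _ ≤ (2 : ℝ) ^ ((1 - α / 2) * (n : ℝ) + 1) :=
        Real.rpow_le_rpow_of_exponent_le (by norm_num) hlt.le
    _ = 2 * (2 : ℝ) ^ ((1 - α / 2) * (n : ℝ)) := by
        rw [Real.rpow_add (by norm_num), Real.rpow_one, mul_comm]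

end UnionCircuit

namespace UnionCircuit

/-! ### Extracting a single coordinate -/

variable {n : ℕ} {C : Circuit (UnionAlgebra n)} {s : State}

/-- Stores the powers of two in array `4`. -/
def powers : Program :=
  .seq (.write 4 (.const 0) (.const 1)) <|
  forLoop 15 2 <| .write 4 (.var 15 + .const 1) (.read 4 (.var 15) + .read 4 (.var 15))

/-- Array `4` holds the powers of two up to `2 ^ n`. -/
def HoldsPowers (n : ℕ) (s : State) : Prop := ∀ j : ℕ, j ≤ n → s.arr 4 j = 2 ^ j

theorem run_powers {N : ℕ} (hN : n ≤ N) (hn : s.var 2 = n) :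
    Run powers s (powers.time N) fun s' => HoldsPowers n s' := by
  refine Run.write_seq (Run.forLoop_time (K := n) hN (fun k s' => ∀ j : ℕ, j ≤ k → s'.arr 4 j = 2 ^ j)
    rfl rfl (by decide) (by simp [hn]) (by simp) ?_)
  intro k s' hk hx hf hI
  refine Run.write fun j hj => ?_
  simp only [State.setVar_arr, State.setArr_arr, if_true, Function.update_apply, Expr.eval, hx, hI k le_rfl]
  split_ifs with h
  · obtain rfl : j = k + 1 := by exact_mod_cast h
    ring
  · exact hI j (by
      have : j ≠ k + 1 := fun h' => h (by exact_mod_cast h')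
      omega)

/-- Treats one binary digit of the number in variable `22`. -/
def decodeDigit : Program :=
  .seq (.assign 23 (.var 2 - .var 15 - .const 1)) <|
  .ifPos (.var 22 - .read 4 (.var 23) + .const 1)
    (.seq (.write 2 (.var 23) (.const 1)) (.assign 22 (.var 22 - .read 4 (.var 23))))
    (.seq (.write 2 (.var 23) (.const 0)) (.assign 21 (.const 0 - .var 21)))

/-- Makes `Y` the set of the binary digits of the number in variable `20` and stores its sign in
variable `21`. -/
def decode : Program :=
  .seq (.assign 22 (.var 20)) <| .seq (.assign 21 (.const 1)) <| forLoop 15 2 decodeDigit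

theorem mod_two_pow_succ (k d : ℕ) :
    k % 2 ^ (d + 1) = k % 2 ^ d + if k.testBit d then 2 ^ d else 0 := by
  rw [Nat.mod_pow_succ, Nat.testBit_eq_decide_div_mod_eq]
  rcases Nat.mod_two_eq_zero_or_one (k / 2 ^ d) with h | h <;> simp [h]

/-- In the absence of division the digits are found from the top, by subtracting each power of two
that still fits. The invariant is that the remainder is `k` modulo the power `2 ^ (n - j)`; each
absent digit flips the sign. -/
theorem run_decode {N : ℕ} (hN : n ≤ N) (hn : s.var 2 = n) (hp : HoldsPowers n s) {k : ℕ}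
    (hk : k < 2 ^ n) (h20 : s.var 20 = k) :
    Run decode s (decode.time N) fun s' => s'.var 21 = bitSign n k ∧
      ∀ d : ℕ, d < n → s'.arr 2 d = if k.testBit d then 1 else 0 := by
  refine Run.assign_seq (Run.assign_seq ((Run.forLoop_time (K := n) hN (fun j s' =>
    s'.var 22 = (k % 2 ^ (n - j) : ℕ) ∧
    s'.var 21 = (∏ d ∈ Finset.Ico (n - j) n, if k.testBit d then 1 else -1) ∧
    ∀ d : ℕ, d < n → n ≤ d + j → s'.arr 2 d = if k.testBit d then 1 else 0)
    rfl rfl (by decide) (by simp [hn])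
    ⟨by simp [h20, Nat.mod_eq_of_lt hk], by simp, fun d hd hd' => by omega⟩ ?_).imp ?_))
  · rintro j s₁ hj hx hf ⟨h22, h21, hI⟩
    obtain ⟨d, hd⟩ : ∃ d, n - j = d + 1 := ⟨n - j - 1, by omega⟩
    have hd' : n - (j + 1) = d := by omega
    have h2' : s₁.var 2 = n := by simp [hf.var 2 rfl, hn]
    have h4' : ∀ m : ℕ, m ≤ n → s₁.arr 4 m = 2 ^ m := fun m hm => by
      rw [hf.arr 4 rfl]
      exact hp m hm
    have hev : (Expr.var 2 - Expr.var 15 - Expr.const 1).eval s₁ = (d : ℕ) := by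
      simp only [Expr.eval, Expr.eval_hSub, h2', hx]
      omega
    rw [hd, mod_two_pow_succ] at h22
    have hlt : k % 2 ^ d < 2 ^ d := Nat.mod_lt _ (Nat.two_pow_pos d)
    have hprod : (∏ d ∈ Finset.Ico d n, if k.testBit d then (1 : ℤ) else -1) =
        (if k.testBit d then (1 : ℤ) else -1) * s₁.var 21 := by
      rw [h21, hd]
      exact Finset.prod_eq_prod_Ico_succ_bot (by omega) _
    have h4d := h4' d (by omega)
    refine Run.assign_seq ?_
    rw [hev]
    by_cases hb : k.testBit d
    · simp only [hb, if_true] at h22 hprod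
      refine (Run.if_pos ?_ (Run.write_seq (Run.assign ⟨?_, ?_, ?_⟩))).mono ?_
      · simp only [Expr.eval, Expr.eval_hSub, State.setVar_var, State.setVar_arr]
        simp [h22, h4d]
        omega
      · simp only [Program.time]
        omega
      · rw [hd']
        simp [h22, h4d]
      · rw [hd', hprod]
        simp
      · intro m hm hm'
        simp only [State.setVar_arr, State.setArr_arr, if_true, Function.update_apply, Expr.eval,
          State.setVar_var]
        split_ifs with h h' h'
        · rfl
        · obtain rfl : m = d := by exact_mod_cast h
          exact absurd hb h'
        · rw [hI m hm (by have : m ≠ d := fun h' => h (by exact_mod_cast h'); omega), if_pos h']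
        · rw [hI m hm (by have : m ≠ d := fun h' => h (by exact_mod_cast h'); omega), if_neg h']
    · simp only [hb, Bool.false_eq_true, if_false] at h22 hprod
      refine (Run.if_neg ?_ (Run.write_seq (Run.assign ⟨?_, ?_, ?_⟩))).mono ?_
      · simp only [Expr.eval, Expr.eval_hSub, State.setVar_var, State.setVar_arr]
        have : ((k % 2 ^ d : ℕ) : ℤ) < 2 ^ d := by exact_mod_cast hlt
        simp [h22, h4d]
        push_cast at this
        omega
      · simp only [Program.time]
        omega
      · rw [hd']
        simp [h22]
      · rw [hd']
        rw [hprod]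
        simp
      · intro m hm hm'
        simp only [State.setVar_arr, State.setArr_arr, if_true, Function.update_apply, Expr.eval,
          State.setVar_var]
        split_ifs with h h' h'
        · obtain rfl : m = d := by exact_mod_cast h
          exact absurd h' hb
        · rfl
        · rw [hI m hm (by have : m ≠ d := fun h' => h (by exact_mod_cast h'); omega), if_pos h']
        · rw [hI m hm (by have : m ≠ d := fun h' => h (by exact_mod_cast h'); omega), if_neg h']
  · rintro s' - ⟨-, h21, h2⟩
    refine ⟨?_, fun d hd => h2 d hd (by omega)⟩
    rw [h21, Nat.sub_self, ← Finset.range_eq_Ico]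
    rfl

/-- Stores the zeta transform at the set with number `e` in variable `11` and the sign of this
number in variable `21`. -/
def evalAt (e : Expr) : Program := .seq (.assign 20 e) <| .seq decode evalCircuit

theorem run_evalAt (hC : C.HasSingletonInputs) (hs : Loaded C s) (hp : HoldsPowers n s) {k : ℕ}
    (hk : k < 2 ^ n) {e : Expr} (he : e.eval s = k) :
    Run (evalAt e) s ((evalAt e).time C.encode.length) fun s' =>
      s'.var 11 = (zeta (bitSet n k) C.output : ℕ) ∧ s'.var 21 = bitSign n k := by
  have hf₀ := (Exec.assign s 20 e).frame
  have hs₀ := hs.frame hf₀ rfl rfl rfl rfl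
  refine Run.assign_seq (Run.seq (run_decode (n_le_length C) hs₀.n hp hk (by simp [he]))
    fun s₁ hf₁ h₁ => (run_evalCircuit hC (hs₀.frame hf₁ rfl rfl rfl rfl)
      (Y := bitSet n k) fun j => ?_).imp fun s' hf h => ⟨h, by rw [hf.var 21 rfl, h₁.1]⟩)
  rw [h₁.2 j j.2]
  simp only [mem_bitSet]

/-- Updates the row `var 24` of the tables `A` and `E`. -/
def updateRow (A E : ℕ) : Program :=
  .seq (.assign 20 (.var 24)) <| .seq decode <|
  .seq (.write E (.var 24 * (.var 2 + .const 1)) (.const 0)) <|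
  .seq (forLoop 29 30 <| .write E (.var 24 * (.var 2 + .const 1) + .var 29 + .const 1)
    (.read E (.var 24 * (.var 2 + .const 1) + .var 29) + .read 2 (.var 29) *
      (.read A (.var 24 - .read 4 (.var 29)) +
        .read E ((.var 24 - .read 4 (.var 29)) * (.var 2 + .const 1) + .var 29)))) <|
  .write A (.var 24) (.var 27 *
    (.var 26 - .read E (.var 24 * (.var 2 + .const 1) + .var 30)))

/-- Array `A` holds the first `K` values of `F`, and array `E` holds its proper partial sums. -/
def HoldsValues (A E : ℕ) (F : ℕ → ℤ) (n i K : ℕ) (s : State) : Prop :=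
  ∀ X < K, s.arr A (X : ℕ) = F X ∧
    ∀ d ≤ i, s.arr E (X * (n + 1) + d : ℕ) = partialSum F d X - F X

/-- Table `E` stores partial sums without the term at `X` itself, so its row can be filled before `F
X` is known, from rows of smaller number only. Then `hval` recovers `F X`: variable `26` supplies
the transform at `X` with factor `1` in variable `27`, or factor `0` declares the value to be zero.
-/
theorem run_updateRow {A E N : ℕ} {F : ℕ → ℤ} {i X : ℕ} (hN : n ≤ N) (hn : s.var 2 = n)
    (hp : HoldsPowers n s) (hAE : A ≠ E) (hE2 : 2 ≠ E) (hE4 : 4 ≠ E) (hA2 : A ≠ 2) (hEA : E ≠ 2)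
    (hi : i ≤ n) (hX : X < 2 ^ i) (hi' : s.var 30 = i) (hX' : s.var 24 = X)
    (hF : HoldsValues A E F n i X s)
    (hval : s.var 27 * (s.var 26 - (partialSum F i X - F X)) = F X) :
    Run (updateRow A E) s ((updateRow A E).time N) fun s' => HoldsValues A E F n i (X + 1) s' := by
  have hXn : X < 2 ^ n := hX.trans_le (Nat.pow_le_pow_right (by norm_num) hi)
  -- Rows are `n + 1` cells wide, so a cell of an earlier row lies before row `X` and is not
  -- overwritten.
  have hidx : ∀ {X' d d' : ℕ}, X' < X → d ≤ n → X' * (n + 1) + d ≠ X * (n + 1) + d' := by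
    intro X' d d' hX' hd h
    have : (X' + 1) * (n + 1) ≤ X * (n + 1) := Nat.mul_le_mul_right _ hX'
    rw [add_mul] at this
    omega
  have hp₀ : HoldsPowers n (s.setVar 20 ((Expr.var 24).eval s)) := hp
  refine Run.assign_seq (Run.seq (run_decode hN (by simp [hn]) hp₀ hXn (by simp [hX'])) ?_)
  rintro s₁ hf₁ ⟨-, hbits⟩
  have hdec : ∀ a, a ≠ 2 → s₁.arr a = s.arr a := fun a ha => by
    rw [hf₁.arr a (by simp [decode, forLoop, decodeDigit, Program.writesArr, ha])]
    rfl
  have h2 : s₁.var 2 = n := by simp [hf₁.var 2 rfl, hn]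
  have h24 : s₁.var 24 = X := by simp [hf₁.var 24 rfl, hX']
  have h30 : s₁.var 30 = i := by simp [hf₁.var 30 rfl, hi']
  have h26 : s₁.var 26 = s.var 26 := by simp [hf₁.var 26 rfl]
  have h27 : s₁.var 27 = s.var 27 := by simp [hf₁.var 27 rfl]
  have h4 : ∀ m : ℕ, m ≤ n → s₁.arr 4 m = 2 ^ m := fun m hm => by
    rw [hdec 4 (by norm_num)]
    exact hp m hm
  refine Run.write_seq (Run.seq (Run.forLoop_time (K := i) (hi.trans hN) (fun d s' =>
    (∀ X' < X, ∀ d ≤ i, s'.arr E (X' * (n + 1) + d : ℕ) = partialSum F d X' - F X') ∧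
    ∀ d' ≤ d, s'.arr E (X * (n + 1) + d' : ℕ) = partialSum F d' X - F X)
    rfl rfl (by decide) (by simp [h30]) ?_ ?_) ?_)
  · simp only [State.setVar_arr, State.setArr_arr, if_true, Function.update_apply, Expr.eval, h24, h2]
    constructor
    · intro X' hX' d hd
      have := hidx (d' := 0) hX' (hd.trans hi)
      rw [if_neg (fun h => this (by exact_mod_cast h)), hdec E hEA, (hF X' hX').2 d hd]
    · intro d' hd'
      obtain rfl : d' = 0 := by omega
      rw [if_pos (by push_cast; ring), partialSum_zero, sub_self]
  · rintro d s₂ hd hx hf₂ ⟨hI, hI'⟩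
    have h2' : s₂.var 2 = n := by simp [hf₂.var 2 rfl, h2]
    have h24' : s₂.var 24 = X := by simp [hf₂.var 24 rfl, h24]
    have harr : ∀ a, a ≠ E → s₂.arr a = s₁.arr a := fun a ha => by
      rw [hf₂.arr a (by simp [forLoop, Program.writesArr, ha])]
      simp [ha]
    have hnew : (Expr.read E (.var 24 * (.var 2 + .const 1) + .var 29) + .read 2 (.var 29) *
        (.read A (.var 24 - .read 4 (.var 29)) + .read E ((.var 24 - .read 4 (.var 29)) *
          (.var 2 + .const 1) + .var 29))).eval s₂ = partialSum F (d + 1) X - F X := by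
      have hE := hI' d le_rfl
      push_cast at hE
      simp only [Expr.eval, Expr.eval_hSub, h2', h24', hx, hE,
        harr 2 hE2, hbits d (by omega), harr 4 hE4, h4 d (by omega), harr A hAE, hdec A hA2]
      -- If the digit is absent, `X - 2 ^ d` does not stand for a subset of `X` and may even be
      -- negative; whatever is read there is multiplied by the bit `0`.
      cases hb : X.testBit d
      · rw [partialSum_succ_of_not_testBit F hb]
        simp
      · rw [partialSum_succ_of_testBit F hb]
        have hle : 2 ^ d ≤ X := Nat.ge_two_pow_of_testBit hb
        have hlt : X - 2 ^ d < X := by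
          have := Nat.two_pow_pos d
          omega
        have hcast : (X : ℤ) - 2 ^ d = ((X - 2 ^ d : ℕ) : ℤ) := by
          push_cast [hle]
          rfl
        rw [hcast, (hF _ hlt).1]
        simp only [if_true, one_mul]
        have hEd : s₂.arr E (((X - 2 ^ d : ℕ) : ℤ) * ((n : ℤ) + 1) + (d : ℤ)) =
            partialSum F d (X - 2 ^ d) - F (X - 2 ^ d) := by
          rw [← hI _ hlt d hd.le]
          congr 1
        rw [hEd]
        ring
    refine Run.write ?_
    rw [hnew]
    simp only [State.setVar_arr, State.setArr_arr, if_true, Function.update_apply, Expr.eval, h24', h2', hx]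
    constructor
    · intro X' hX' d' hd'
      have := hidx (d' := d + 1) hX' (hd'.trans hi)
      rw [if_neg (fun h => this (by rw [← add_assoc]; exact_mod_cast h)), hI X' hX' d' hd']
    · intro d' hd'
      split_ifs with h
      · obtain rfl : d' = d + 1 := by
          have h' : X * (n + 1) + d' = X * (n + 1) + d + 1 := by exact_mod_cast h
          omega
        rfl
      · refine hI' d' ?_
        have : d' ≠ d + 1 := by
          rintro rfl
          exact h (by push_cast; ring)
        omega
  · rintro s₂ hf₂ ⟨hI, hI'⟩
    have harr : ∀ a, a ≠ E → s₂.arr a = s₁.arr a := fun a ha => by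
      rw [hf₂.arr a (by simp [forLoop, Program.writesArr, ha])]
      simp [ha]
    have hE := hI' i le_rfl
    push_cast at hE
    refine Run.write fun X₁ hX₁ => ?_
    simp only [State.setArr_arr, if_true, Function.update_apply, Expr.eval, Expr.eval_hSub, hf₂.var 24 rfl, hf₂.var 26 rfl, hf₂.var 27 rfl,
      hf₂.var 2 rfl, hf₂.var 30 rfl, State.setArr_var, h24, h26, h27, h2, h30, hE, hval, hAE.symm,
      if_false]
    constructor
    · split_ifs with h
      · rw [show X₁ = X by exact_mod_cast h]
      · have : X₁ ≠ X := fun h' => h (by exact_mod_cast h')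
        rw [harr A hAE, hdec A hA2, (hF X₁ (by omega)).1]
    · intro d hd
      rcases Nat.lt_or_eq_of_le (Nat.le_of_lt_succ hX₁) with h | rfl
      · exact hI X₁ h d hd
      · exact hI' d hd

end UnionCircuit

namespace UnionCircuit

/-! ### Filling the tables of `lowSum` and `topCoord` -/

variable {n : ℕ} {C : Circuit (UnionAlgebra n)} {s : State}

/-- Fills the tables `A` and `E`, where `P` prepares the data of each row. -/
def pass (A E : ℕ) (P : Program) : Program := forLoop 24 25 (.seq P (updateRow A E))

/-- The cost `T X` of preparing a row depends on the row, so cheap and expensive rows can be summed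
separately. -/
theorem run_pass {A E N : ℕ} {P : Program} {F : ℕ → ℤ} {i : ℕ} {T : ℕ → ℕ} (hN : n ≤ N)
    (hn : s.var 2 = n) (hp : HoldsPowers n s) (hAE : A ≠ E) (hE2 : 2 ≠ E) (hE4 : 4 ≠ E)
    (hA2 : 2 ≠ A) (hA4 : 4 ≠ A) (hi : i ≤ n) (hi' : s.var 30 = i) (h25 : s.var 25 = (2 ^ i : ℕ))
    (hP2 : P.writesVar 2 = false) (hP24 : P.writesVar 24 = false) (hP25 : P.writesVar 25 = false)
    (hP30 : P.writesVar 30 = false) (hP4 : P.writesArr 4 = false) (hPA : P.writesArr A = false)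
    (hPE : P.writesArr E = false)
    (hP : ∀ (X : ℕ) (s' : State), X < 2 ^ i → s'.var 24 = X → Frame (pass A E P) s s' →
      Run P s' (T X) fun s'' => s''.var 27 * (s''.var 26 - (partialSum F i X - F X)) = F X) :
    Run (pass A E P) s
      ((∑ X ∈ Finset.range (2 ^ i), (T X + (updateRow A E).time N + 8)) + 6)
      fun s' => HoldsValues A E F n i (2 ^ i) s' := by
  refine Run.forLoop_sum (T := fun X => T X + (updateRow A E).time N)
    (fun X s' => HoldsValues A E F n i X s') ?_ ?_ (by decide) h25 (fun X hX => by omega) ?_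
  · simp [Program.writesVar, hP24, updateRow, decode, forLoop, decodeDigit]
  · simp [Program.writesVar, hP25, updateRow, decode, forLoop, decodeDigit]
  · intro X s₁ hX hx hf hI
    refine Run.seq (hP X s₁ hX hx hf) fun s₂ hf₂ h => ?_
    have hv : ∀ x, (pass A E P).writesVar x = false → P.writesVar x = false →
        s₂.var x = s.var x := fun x h1 h2 => by rw [hf₂.var x h2, hf.var x h1]
    have h2 : s₂.var 2 = n := by
      rw [hv 2 _ hP2, hn]
      simp [pass, Program.writesVar, hP2, updateRow, decode, forLoop, decodeDigit]
    have h30 : s₂.var 30 = i := by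
      rw [hv 30 _ hP30, hi']
      simp [pass, Program.writesVar, hP30, updateRow, decode, forLoop, decodeDigit]
    have h4 : HoldsPowers n s₂ := fun j hj => by
      rw [hf₂.arr 4 hP4, hf.arr 4, hp j hj]
      simp [Program.writesArr, hP4, updateRow, decode, forLoop, decodeDigit, hE4, hA4]
    exact run_updateRow hN h2 h4 hAE hE2 hE4 hA2.symm hE2.symm hi hX h30
      (by rw [hf₂.var 24 hP24, hx]) (fun X' hX' => by rw [hf₂.arr A hPA, hf₂.arr E hPE]; exact hI X' hX') h

/-- The number of the set that consists of the set with number `var 24` and of all elements from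
`var 30` on. -/
def fullIndex : Expr := .var 24 + .read 4 (.var 2) - .read 4 (.var 30)

/-- All elements from `i` on together have number `2 ^ n - 2 ^ i`. -/
theorem fullIndex_eval {i X : ℕ} (hn : s.var 2 = n) (hp : HoldsPowers n s) (hi : i ≤ n)
    (hi' : s.var 30 = i) (hX' : s.var 24 = X) :
    fullIndex.eval s = (2 ^ i * (2 ^ (n - i) - 1) + X : ℕ) := by
  have h : 2 ^ n = 2 ^ i * 2 ^ (n - i) := by rw [← pow_add, Nat.add_sub_cancel' hi]
  have h1 : (((2 ^ (n - i) - 1 : ℕ)) : ℤ) = 2 ^ (n - i) - 1 := by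
    have := Nat.two_pow_pos (n - i)
    push_cast [this]
    rfl
  have h2 : (2 : ℤ) ^ n = 2 ^ i * 2 ^ (n - i) := by exact_mod_cast h
  simp only [fullIndex, Expr.eval, Expr.eval_hSub, hn, hi', hX', hp n le_rfl, hp i hi]
  rw [Nat.cast_add, Nat.cast_mul, h1, h2]
  push_cast
  ring

theorem mul_add_lt_two_pow {i X Z : ℕ} (hi : i ≤ n) (hX : X < 2 ^ i) (hZ : Z < 2 ^ (n - i)) :
    2 ^ i * Z + X < 2 ^ n :=
  calc 2 ^ i * Z + X < 2 ^ i * (Z + 1) := by rw [mul_add]; omega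
    _ ≤ 2 ^ i * 2 ^ (n - i) := Nat.mul_le_mul_left _ hZ
    _ = 2 ^ n := by rw [← pow_add, Nat.add_sub_cancel' hi]

/-- Prepares the data for the table of the sums `lowSum`. -/
def lowRow : Program :=
  .seq (evalAt fullIndex) <| .seq (.assign 26 (.var 11)) <| .assign 27 (.const 1)

theorem run_lowRow (hC : C.HasSingletonInputs) (hs : Loaded C s) (hp : HoldsPowers n s) {i X : ℕ}
    (hi : i ≤ n) (hi' : s.var 30 = i) (hX : X < 2 ^ i) (hX' : s.var 24 = X) :
    Run lowRow s (lowRow.time C.encode.length) fun s' => s'.var 27 * (s'.var 26 -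
      (partialSum (fun X => lowSum C.output i X) i X - lowSum C.output i X)) =
        lowSum C.output i X := by
  refine Run.seq (run_evalAt hC hs hp ?_ (fullIndex_eval hs.n hp hi hi' hX'))
    fun s₁ _ h₁ => Run.assign_seq (Run.assign ?_)
  · exact mul_add_lt_two_pow hi hX (Nat.sub_lt (Nat.two_pow_pos _) one_pos)
  · simp [h₁.1, zeta_full_mul_add _ hi hX]

/-- Adds one term of the alternating sum of the values of the zeta transform. -/
def addTerm : Program :=
  .seq (evalAt (.var 24 + .read 4 (.var 30) * .var 33)) <|
  .assign 26 (.var 26 + .var 21 * .var 11)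

/-- Prepares the data for the table of the coordinates `topCoord`. -/
def topRow : Program :=
  .ifPos (.read 5 (.var 24))
    (.seq (.assign 20 fullIndex) <| .seq decode <| .seq (.assign 31 (.var 21)) <|
      .seq (.assign 26 (.const 0)) <| .seq (forLoop 33 34 addTerm) <|
      .seq (.assign 26 (.var 26 * .var 31)) <| .assign 27 (.const 1))
    (.assign 27 (.const 0))

/-- The `2 ^ (n - i)` queries are made only if `lowSum` is positive; otherwise `topCoord` is zero
and the factor in variable `27` is set to `0`. The available signs involve all `n` digits, but the
low digits contribute a common sign, which is also the sign of the index with full upper part and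
cancels on multiplying by it. -/
theorem run_topRow (hC : C.HasSingletonInputs) (hs : Loaded C s) (hp : HoldsPowers n s) {i X : ℕ}
    (hi : i ≤ n) (hi' : s.var 30 = i) (hX : X < 2 ^ i) (hX' : s.var 24 = X)
    (h34 : s.var 34 = (2 ^ (n - i) : ℕ)) (h5 : s.arr 5 X = lowSum C.output i X) :
    Run topRow s (decode.time C.encode.length + 40 + if 0 < lowSum C.output i X then
        2 ^ (n - i) * (addTerm.time C.encode.length + 8) else 0) fun s' => s'.var 27 * (s'.var 26 -
      (partialSum (fun X => topCoord C.output i X) i X - topCoord C.output i X)) =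
        topCoord C.output i X := by
  by_cases hpos : 0 < lowSum C.output i X
  · have hf₀ := (Exec.assign s 20 fullIndex).frame
    have hs₀ := hs.frame hf₀ rfl rfl rfl rfl
    rw [if_pos hpos]
    refine Run.mono (T := 2 + 1 + (7 + 1 + (decode.time C.encode.length + (2 + (2 +
      ((2 ^ (n - i) * (addTerm.time C.encode.length + 8) + 6) + (4 + 2))))))) ?_ (by omega)
    refine Run.if_pos (by simp [hX', h5, hpos]) (Run.assign_seq (Run.seq
      (run_decode (n_le_length C) hs₀.n hp (k := 2 ^ i * (2 ^ (n - i) - 1) + X)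
        (mul_add_lt_two_pow hi hX (Nat.sub_lt (Nat.two_pow_pos _) one_pos))
        (by simp [fullIndex_eval hs.n hp hi hi' hX'])) ?_))
    · rintro s₁ hf₁ ⟨h21, -⟩
      refine Run.assign_seq (Run.assign_seq (Run.seq (Run.forLoop (K := 2 ^ (n - i)) (fun Z s' =>
        s'.var 26 = ∑ Z' ∈ Finset.range Z, bitSign n (2 ^ i * Z' + X) *
          zeta (bitSet n (2 ^ i * Z' + X)) C.output) rfl rfl (by decide)
        (by simp [hf₁.var 34 rfl, h34]) (by simp) ?_) ?_))
      · intro Z s₂ hZ hx hf₂ hI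
        have hs₁ := hs₀.frame hf₁ rfl rfl rfl rfl
        have hs₂ := Loaded.frame (s := (s₁.setVar 31 _).setVar 26 _)
          ⟨hs₁.arr, hs₁.n, hs₁.size, hs₁.out⟩ hf₂ rfl rfl rfl rfl
        have hp₂ : HoldsPowers n s₂ := fun j hj => by
          rw [hf₂.arr 4 rfl]
          exact (congrFun (hf₁.arr 4 rfl) j).trans (hp j hj)
        have h30 : s₂.var 30 = i := by simp [hf₂.var 30 rfl, hf₁.var 30 rfl, hi']
        have h24 : s₂.var 24 = X := by simp [hf₂.var 24 rfl, hf₁.var 24 rfl, hX']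
        refine Run.seq (run_evalAt hC hs₂ hp₂ (mul_add_lt_two_pow hi hX hZ) ?_)
          fun s₃ hf₃ h₃ => Run.assign ?_
        · simp [h30, h24, hx, hp₂ i hi]
          ring
        · simp [hf₃.var 26 rfl, hI, h₃.1, h₃.2, Finset.sum_range_succ]
      · intro s₂ hf₂ h26
        refine Run.assign_seq (Run.assign ?_)
        have h31 : s₂.var 31 = bitSign n (2 ^ i * (2 ^ (n - i) - 1) + X) := by
          simp [hf₂.var 31 rfl, h21]
        have hsign : ∀ Z, bitSign n (2 ^ i * Z + X) = bitSign i X * bitSign (n - i) Z := fun Z => by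
          rw [← bitSign_mul_add hX, Nat.add_sub_cancel' hi]
        have hsum : s₂.var 26 * s₂.var 31 = partialSum (fun X => topCoord C.output i X) i X := by
          rw [h26, h31, hsign, bitSign_full, ← sum_bitSign_zeta _ hi hX, Finset.sum_mul]
          refine Finset.sum_congr rfl fun Z _ => ?_
          rw [hsign]
          -- The sign of `X` occurs twice and squares to one.
          linear_combination (bitSign (n - i) Z * zeta (bitSet n (2 ^ i * Z + X)) C.output) *
            bitSign_mul_self i X
        simp [hsum]
  · rw [if_neg hpos]
    have h0 : lowSum C.output i X = 0 := by omega
    refine (Run.if_neg (by simp [hX', h5, h0]) (Run.assign ?_)).mono ?_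
    · simp [topCoord_eq_zero _ h0]
    · simp only [Expr.cost]
      omega

/-- Counts the non-zero values of `lowSum`. -/
def countRow : Program := .ifPos (.read 5 (.var 24)) (.assign 35 (.var 35 + .const 1)) .skip

/-- Stores the number of the non-zero values of `lowSum` in variable `35`. -/
def countRows : Program := .seq (.assign 35 (.const 0)) (forLoop 24 25 countRow)

theorem run_countRows {v : UnionAlgebra n} {i : ℕ} (h25 : s.var 25 = (2 ^ i : ℕ))
    (h5 : ∀ X < 2 ^ i, s.arr 5 (X : ℕ) = lowSum v i X) :
    Run countRows s (2 ^ i * 20 + 10) fun s' => s'.var 35 = lowCount v i := by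
  refine (Run.assign_seq (Run.forLoop (K := 2 ^ i) (T := 12) (fun X s' =>
    s'.var 35 = (((Finset.range X).filter fun X => 0 < lowSum v i X).card : ℕ)) rfl rfl (by decide)
    (by simp [h25]) (by simp) ?_)).mono ?_
  · intro X s₁ hX hx hf hI
    have h := h5 X hX
    have h5' : s₁.arr 5 = s.arr 5 := by rw [hf.arr 5 rfl]; rfl
    refine Run.mono (T := 3 + (4 + 1)) (Run.ifPos (fun hpos => Run.assign ?_) fun hpos => Run.skip ?_)
      (by norm_num)
    · simp only [Expr.eval, hx, h5', h] at hpos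
      have hpos' : 0 < lowSum v i X := by exact_mod_cast hpos
      simp [Finset.range_add_one, Finset.filter_insert, hpos', hI]
    · simp only [Expr.eval, hx, h5', h] at hpos
      have hpos' : ¬ 0 < lowSum v i X := by exact_mod_cast hpos
      simp [Finset.range_add_one, Finset.filter_insert, hpos', hI]
  · simp only [Expr.cost]
    omega

end UnionCircuit

namespace UnionCircuit

/-! ### Searching for a balanced split -/

variable {n : ℕ} {C : Circuit (UnionAlgebra n)} {s : State}

/-- Tabulates `topCoord` and stores the coordinate at the full set in variable `38`. -/
def topStep : Program :=
  .seq (pass 7 8 topRow) <| .seq (.assign 38 (.read 7 (.var 25 - .const 1))) <|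
  .assign 37 (.const 1)

/-- Tabulates `lowSum` for the split at `var 30` and, if it is balanced, computes the result. -/
def splitStep : Program :=
  .seq (.assign 25 (.read 4 (.var 30))) <|
  .seq (.assign 34 (.read 4 (.var 2 - .var 30))) <|
  .seq (pass 5 6 lowRow) <| .seq countRows <|
  .ifPos (.var 35 * .var 34 - .var 25) .skip topStep

/-- Computes the coordinate of the output at the full set. -/
def extractTop : Program :=
  .seq load <| .seq powers <| .seq (.assign 36 (.var 2 + .const 1)) <|
  .seq (forLoop 30 36 (.ifPos (.var 37) .skip splitStep)) <|
  .seq (.write 1 (.const 0) (.var 38)) (.assign 1 (.const 1))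

/-- A bound on the running time of `topStep`, where `K` is the number of the rows. -/
def topStepTime (N K : ℕ) : ℕ :=
  (K * (decode.time N + 40 + (updateRow 7 8).time N + 8 + (addTerm.time N + 8)) + 6) + (5 + 2)

/-- A bound on the running time of `splitStep`, where `K` is the number of the rows. -/
def splitStepTime (N K : ℕ) : ℕ :=
  3 + (5 + ((K * (lowRow.time N + (updateRow 5 6).time N + 8) + 6) +
    ((K * 20 + 10) + (5 + 1 + (1 + topStepTime N K)))))

theorem splitStepTime_mono (N : ℕ) {K K' : ℕ} (h : K ≤ K') :
    splitStepTime N K ≤ splitStepTime N K' := by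
  unfold splitStepTime topStepTime
  gcongr

/-- The alternating sums take `lowCount * 2 ^ (n - i)` queries in total, which balance bounds by `2
^ i`, the number of rows. -/
theorem run_topStep (hC : C.HasSingletonInputs) (hs : Loaded C s) (hp : HoldsPowers n s) {i : ℕ}
    (hi : i ≤ n) (hi' : s.var 30 = i) (h25 : s.var 25 = (2 ^ i : ℕ))
    (h34 : s.var 34 = (2 ^ (n - i) : ℕ))
    (h5 : ∀ X < 2 ^ i, s.arr 5 (X : ℕ) = lowSum C.output i X) (hb : Balanced C.output i) :
    Run topStep s (topStepTime C.encode.length (2 ^ i)) fun s' =>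
      s'.var 37 = 1 ∧ s'.var 38 = coord C.output Finset.univ := by
  refine Run.seq ((run_pass (F := fun X => topCoord C.output i X) (n_le_length C) hs.n hp
    (by decide) (by decide) (by decide) (by decide) (by decide) hi hi' h25 rfl rfl rfl rfl rfl rfl rfl
    fun X s₁ hX hx hf => run_topRow hC (hs.frame hf rfl rfl rfl rfl)
      (fun j hj => by rw [hf.arr 4 rfl, hp j hj]) hi (by rw [hf.var 30 rfl, hi']) hX hx
      (by rw [hf.var 34 rfl, h34]) (by rw [hf.arr 5 rfl, h5 X hX])).mono ?_) ?_
  · have h : ∑ X ∈ Finset.range (2 ^ i), (if 0 < lowSum C.output i X then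
        2 ^ (n - i) * (addTerm.time C.encode.length + 8) else 0) =
        lowCount C.output i * 2 ^ (n - i) * (addTerm.time C.encode.length + 8) := by
      rw [← Finset.sum_filter, Finset.sum_const, smul_eq_mul, lowCount, mul_assoc]
    have h' := Nat.mul_le_mul_right (addTerm.time C.encode.length + 8) hb
    simp only [Finset.sum_add_distrib, h, Finset.sum_const, Finset.card_range, smul_eq_mul]
    linarith
  · intro s₁ hf hv
    refine Run.assign_seq (Run.assign ⟨by simp, ?_⟩)
    have h := (hv (2 ^ i - 1) (Nat.sub_lt (Nat.two_pow_pos i) one_pos)).1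
    beta_reduce at h
    rw [topCoord_full _ hi] at h
    have h1 : (((2 ^ i - 1 : ℕ)) : ℤ) = 2 ^ i - 1 := by
      have := Nat.two_pow_pos i
      push_cast [this]
      rfl
    rw [h1] at h
    simp [hf.var 25 rfl, h25, h]

/-- Deciding balance needs only the cheap table of `lowSum`; the expensive table is started only
after the test succeeds, so each trial costs about `2 ^ i`. -/
theorem run_splitStep (hC : C.HasSingletonInputs) (hs : Loaded C s) (hp : HoldsPowers n s) {i : ℕ}
    (hi : i ≤ n) (hi' : s.var 30 = i) (h37 : s.var 37 = 0) :
    Run splitStep s (splitStepTime C.encode.length (2 ^ i)) fun s' =>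
      ¬ Balanced C.output i ∧ s'.var 37 = 0 ∨
      Balanced C.output i ∧ s'.var 37 = 1 ∧ s'.var 38 = coord C.output Finset.univ := by
  have hf₀ := ((Exec.assign s 25 (.read 4 (.var 30))).seq
    (.assign _ 34 (.read 4 (.var 2 - .var 30)))).frame
  refine Run.assign_seq (Run.assign_seq ?_)
  set s₀ := (s.setVar 25 ((Expr.read 4 (.var 30)).eval s)).setVar 34
    ((Expr.read 4 (.var 2 - .var 30)).eval (s.setVar 25 ((Expr.read 4 (.var 30)).eval s))) with hs₀'
  have hs₀ := hs.frame hf₀ rfl rfl rfl rfl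
  have hp₀ : HoldsPowers n s₀ := hp
  have h30 : s₀.var 30 = i := by simp [hs₀', hi']
  have h25 : s₀.var 25 = (2 ^ i : ℕ) := by simp [hs₀', hi', hp i hi]
  have h34 : s₀.var 34 = (2 ^ (n - i) : ℕ) := by
    have := hp (n - i) (Nat.sub_le n i)
    rw [Nat.cast_sub hi] at this
    simp [hs₀', hi', hs.n, this]
  refine Run.seq ((run_pass (F := fun X => lowSum C.output i X) (n_le_length C) hs₀.n hp₀
    (by decide) (by decide) (by decide) (by decide) (by decide) hi h30 h25 rfl rfl rfl rfl rfl rfl rfl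
    fun X s₁ hX hx hf => run_lowRow hC (hs₀.frame hf rfl rfl rfl rfl)
      (fun j hj => by rw [hf.arr 4 rfl, hp₀ j hj]) hi (by rw [hf.var 30 rfl, h30]) hX hx).mono
    (by simp)) ?_
  intro s₁ hf₁ hv₁
  have h5 : ∀ X < 2 ^ i, s₁.arr 5 (X : ℕ) = lowSum C.output i X := fun X hX => (hv₁ X hX).1
  refine Run.seq (run_countRows (by rw [hf₁.var 25 rfl, h25]) h5) fun s₂ hf₂ h35 => ?_
  have h25₂ : s₂.var 25 = (2 ^ i : ℕ) := by rw [hf₂.var 25 rfl, hf₁.var 25 rfl, h25]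
  have h34₂ : s₂.var 34 = (2 ^ (n - i) : ℕ) := by rw [hf₂.var 34 rfl, hf₁.var 34 rfl, h34]
  have h37₂ : s₂.var 37 = 0 := by rw [hf₂.var 37 rfl, hf₁.var 37 rfl]; simp [hs₀', h37]
  have htest : 0 < (Expr.var 35 * .var 34 - .var 25).eval s₂ ↔ ¬ Balanced C.output i := by
    rw [Balanced, not_le, Expr.eval_hSub, Expr.eval_hMul]
    simp only [Expr.eval, h35, h34₂, h25₂, sub_pos]
    exact_mod_cast Iff.rfl
  refine Run.ifPos (fun h => Run.skip (Or.inl ⟨htest.1 h, h37₂⟩)) fun h => ?_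
  have hb : Balanced C.output i := not_not.1 fun hb => h (htest.2 hb)
  refine (run_topStep hC ((hs₀.frame hf₁ rfl rfl rfl rfl).frame hf₂ rfl rfl rfl rfl)
    (fun j hj => by rw [hf₂.arr 4 rfl, hf₁.arr 4 rfl, hp₀ j hj]) hi
    (by rw [hf₂.var 30 rfl, hf₁.var 30 rfl, h30]) h25₂ h34₂ (fun X hX => by rw [hf₂.arr 5 rfl, h5 X hX])
    hb).imp fun s' _ h => Or.inr ⟨hb, h⟩

/-- A bound on the running time of `extractTop`, where `K` is the largest number of rows. -/
def extractTopTime (N K : ℕ) : ℕ :=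
  9 + (powers.time N + (4 + ((((N + 1) * (2 + (1 + splitStepTime N K) + 8)) + 6) + (3 + 2))))

open Classical in
theorem run_extractTop (hC : C.HasSingletonInputs) :
    Run extractTop (State.start C.encode) (extractTopTime C.encode.length
      (2 ^ Nat.find ⟨n, balanced_self C.output⟩))
      fun s => s.HasOutput [(coord C.output Finset.univ : ℤ)] := by
  set i := Nat.find ⟨n, balanced_self C.output⟩ with hi
  have hin : i ≤ n := Nat.find_min' _ (balanced_self C.output)
  refine Run.seq (run_load C) fun s₁ hf₁ hs₁ => ?_
  refine Run.seq (run_powers (n_le_length C) hs₁.n) fun s₂ hf₂ hp₂ => ?_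
  have hs₂ := hs₁.frame hf₂ rfl rfl rfl rfl
  have h37 : s₂.var 37 = 0 := by
    rw [hf₂.var 37 rfl, hf₁.var 37 rfl]
    simp [State.start]
  have hf₃ := (Exec.assign s₂ 36 (.var 2 + .const 1)).frame
  have hs₃ := hs₂.frame hf₃ rfl rfl rfl rfl
  -- Variable `37` flags success and makes the remaining rounds trivial. No round goes beyond the
  -- least balanced `i`, so each is charged at that size.
  refine Run.assign_seq (Run.seq ((Run.forLoop (K := n + 1)
    (T := 2 + (1 + splitStepTime C.encode.length (2 ^ i))) (fun k s =>
      (s.var 37 = 0 ∧ k ≤ i) ∨ (s.var 37 = 1 ∧ s.var 38 = coord C.output Finset.univ))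
    rfl rfl (by decide) (by simp [hs₂.n]) (Or.inl (by simp [h37])) ?_).mono ?_) ?_)
  · intro k s hk hx hf hI
    refine Run.ifPos (fun h => Run.skip ?_) fun h => ?_
    · rcases hI with hI | hI
      · simp [hI.1] at h
      · exact Or.inr (by simpa using hI)
    · obtain ⟨h0, hki⟩ : s.var 37 = 0 ∧ k ≤ i := by
        rcases hI with hI | hI
        · exact hI
        · simp [hI.1] at h
      refine ((run_splitStep hC (hs₃.frame hf rfl rfl rfl rfl)
        (fun j hj => by rw [hf.arr 4 rfl]; exact hp₂ j hj) (hki.trans hin) hx h0).mono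
        (splitStepTime_mono _ (Nat.pow_le_pow_right (by norm_num) hki))).imp ?_
      rintro s' - (⟨hb, h'⟩ | ⟨-, h'⟩)
      · refine Or.inl ⟨by simpa using h', ?_⟩
        rcases Nat.lt_or_eq_of_le hki with hlt | rfl
        · exact hlt
        · exact absurd (Nat.find_spec ⟨n, balanced_self C.output⟩) hb
      · exact Or.inr (by simpa using h')
  · have := n_le_length C
    gcongr
  · rintro s hf hI
    obtain ⟨-, h38⟩ : s.var 37 = 1 ∧ s.var 38 = coord C.output Finset.univ := by
      rcases hI with hI | hI
      -- All `n + 1` splits would have been tried without success, although the least balanced one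
      -- is at most `n`.
      · omega
      · exact hI
    refine Run.write_seq (Run.assign ⟨by simp, fun j hj => ?_⟩)
    obtain rfl : j = 0 := by simpa using hj
    simp [h38]

/-! ### Polynomial bounds -/

/-- One step is linear in `M`, because a residual subtracts at most `M` entries, and there are at
most `M` steps. The hypothesis `1 ≤ M` absorbs the terms free of `M`. -/
theorem listSupportTime_le : ∃ f : ℕ → ℕ, PolyBounded f ∧
    ∀ N M, 1 ≤ M → listSupportTime N M ≤ f N * M ^ 2 := by
  set r : ℕ → ℕ := fun N => evalCircuit.time N + (subtractEntry.time N + 14) with hr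
  set l : ℕ → ℕ := fun N => N * (r N + 20) + (r N + (appendEntry.time N + (fillSet.time N + 8))) with hl
  have hrp : PolyBounded r :=
    (Program.time_polyBounded _).add ((Program.time_polyBounded _).add (.const _))
  have hlp : PolyBounded l := (PolyBounded.id.mul (hrp.add (.const _))).add
    (hrp.add ((Program.time_polyBounded _).add ((Program.time_polyBounded _).add (.const _))))
  refine ⟨fun N => l N + (fillSet.time N + (evalCircuit.time N + 19)), hlp.add
    ((Program.time_polyBounded _).add ((Program.time_polyBounded _).add (.const _))), ?_⟩
  intro N M hM
  have hres : residualTime N M ≤ r N * M := by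
    simp only [residualTime, hr]
    nlinarith [Nat.zero_le (evalCircuit.time N), Nat.zero_le (subtractEntry.time N)]
  have hstep : listStepTime N M ≤ l N * M := by
    have h1 : N * (residualTime N M + 20) ≤ N * (r N + 20) * M := by
      rw [mul_assoc]
      refine Nat.mul_le_mul_left _ ?_
      nlinarith
    have h2 : appendEntry.time N + (fillSet.time N + 8) ≤
        (appendEntry.time N + (fillSet.time N + 8)) * M := Nat.le_mul_of_pos_right _ hM
    simp only [listStepTime, hl]
    linarith
  have h1 : M * (listStepTime N M + 1 + 1) ≤ (l N + 2) * M ^ 2 := by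
    calc M * (listStepTime N M + 1 + 1) ≤ M * (l N * M + 2 * M) := by
          refine Nat.mul_le_mul_left _ ?_
          omega
      _ = (l N + 2) * M ^ 2 := by ring
  have h2 : fillSet.time N + (evalCircuit.time N + 17) ≤
      (fillSet.time N + (evalCircuit.time N + 17)) * M ^ 2 :=
    Nat.le_mul_of_pos_right _ (by positivity)
  have h3 : residualTime N 0 = evalCircuit.time N + 6 := by simp [residualTime]
  simp only [listSupportTime, h3]
  linarith

/-- The factor `2` is included in advance to pay for rounding the split up to an integer. -/
theorem extractTopTime_le : ∃ f : ℕ → ℕ, PolyBounded f ∧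
    ∀ N K, 1 ≤ K → 2 * extractTopTime N K ≤ f N * K := by
  set a : ℕ → ℕ := fun N => decode.time N + 40 + (updateRow 7 8).time N + 8 + (addTerm.time N + 8)
    with ha
  set b : ℕ → ℕ := fun N => lowRow.time N + (updateRow 5 6).time N + 8 with hb
  have hap : PolyBounded a := ((((Program.time_polyBounded _).add (.const _)).add
    (Program.time_polyBounded _)).add (.const _)).add ((Program.time_polyBounded _).add (.const _))
  have hbp : PolyBounded b :=
    ((Program.time_polyBounded _).add (Program.time_polyBounded _)).add (.const _)
  refine ⟨fun N => 2 * (powers.time N + ((N + 1) * (a N + b N + 100) + 24)),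
    (PolyBounded.const 2).mul ((Program.time_polyBounded _).add (((PolyBounded.id.add (.const 1)).mul
      ((hap.add hbp).add (.const _))).add (.const _))), ?_⟩
  intro N K hK
  have h1 : 2 + (1 + splitStepTime N K) + 8 ≤ (a N + b N + 100) * K := by
    simp only [splitStepTime, topStepTime]
    change 2 + (1 + (3 + (5 + ((K * b N + 6) + ((K * 20 + 10) + (5 + 1 + (1 + ((K * a N + 6) + (5 + 2))))))))) + 8 ≤ _
    nlinarith
  have h2 : (N + 1) * (2 + (1 + splitStepTime N K) + 8) ≤ (N + 1) * (a N + b N + 100) * K := by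
    rw [mul_assoc]
    exact Nat.mul_le_mul_left _ h1
  have h3 : powers.time N + 24 ≤ (powers.time N + 24) * K := Nat.le_mul_of_pos_right _ hK
  simp only [extractTopTime]
  linarith

end UnionCircuit

/-! ### Both algorithms with their polynomial factors -/

open UnionCircuit in
theorem mainTheorem1 :
    (∃ (P : Program) (p : Polynomial ℕ), ∀ (n : ℕ) (C : Circuit (UnionAlgebra n)),
      C.HasSingletonInputs →
        ∃ (t : ℕ) (L : List (Finset (Fin n))),
          L.Nodup ∧ (∀ X, X ∈ L ↔ X ∈ supp C.output) ∧
          Computes P C.encode (encodeTable C.output L) t ∧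
          t ≤ p.eval C.encode.length * (supp C.output).card ^ 2) ∧
    (∃ (P : Program) (p : Polynomial ℕ), ∀ (n : ℕ) (C : Circuit (UnionAlgebra n)),
      C.HasSingletonInputs →
        ∃ t : ℕ,
          Computes P C.encode [(coord C.output Finset.univ : ℤ)] t ∧
          ∀ α : ℝ, 0 < α → α ≤ 1 / 2 →
            ((supp C.output).card : ℝ) ≤ (2 : ℝ) ^ ((1 - α) * (n : ℝ)) →
            (t : ℝ) ≤ ((p.eval C.encode.length : ℕ) : ℝ) * (2 : ℝ) ^ ((1 - α / 2) * (n : ℝ))) := by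
  classical
  constructor
  · obtain ⟨f, ⟨p, hp⟩, hf⟩ := listSupportTime_le
    refine ⟨listSupport, p, fun n C hC => ?_⟩
    obtain ⟨s, t, hex, ht, L, hnd, hL, hout⟩ := run_listSupport hC
    refine ⟨t, L, hnd, hL, ⟨s, hex, hout⟩, ht.trans ((hf _ _ ?_).trans ?_)⟩
    · exact Finset.card_pos.2 (supp_output_nonempty C hC)
    · exact Nat.mul_le_mul_right _ (hp _)
  · obtain ⟨f, ⟨p, hp⟩, hf⟩ := extractTopTime_le
    refine ⟨extractTop, p, fun n C hC => ?_⟩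
    obtain ⟨s, t, hex, ht, hout⟩ := run_extractTop hC
    refine ⟨t, ⟨s, hex, hout⟩, fun α h0 h1 hα => ?_⟩
    -- The program and its time do not depend on `α`, which enters only here, in bounding the least
    -- balanced split.
    have hK := two_pow_find_balanced_le C.output h0 h1 hα
    set K := 2 ^ Nat.find ⟨n, balanced_self C.output⟩ with hKdef
    have h2 : 2 * t ≤ p.eval C.encode.length * K :=
      (Nat.mul_le_mul_left 2 ht).trans ((hf _ _ (Nat.two_pow_pos _)).trans
        (Nat.mul_le_mul_right _ (hp _)))
    have h2' : 2 * (t : ℝ) ≤ ((p.eval C.encode.length : ℕ) : ℝ) * (K : ℝ) := by exact_mod_cast h2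
    have h3 : (K : ℝ) ≤ 2 * (2 : ℝ) ^ ((1 - α / 2) * (n : ℝ)) := by
      rw [hKdef]
      exact_mod_cast hK
    have h4 := mul_le_mul_of_nonneg_left h3 (Nat.cast_nonneg (α := ℝ) (p.eval C.encode.length))
    linarith
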